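/- **Theorem (rate-distortion regret bounds).** Let $\mathcal X,\mathcal Y$ be standard Borel spaces (for instance finite sets or finite-dimensional real vector spaces), let $\Theta$ be a measurable space of environments, where each $\theta\in\Theta$ prescribes to every input $x\in\mathcal X$ a probability measure $\theta(\cdot|x)$ on $\mathcal Y$, jointly measurably in $(\theta,x)$. Let $(\Omega,\mathbb F,\mathbb P)$ be a probability space that carries a random environment $\mathcal E:\Omega\to\Theta$, inputs $X_0,X_1,\dots$ with values in $\mathcal X$ and outputs $Y_1,Y_2,\dots$ with values in $\mathcal Y$. Write $H_t=(X_0,Y_1,\dots,X_{t-1},Y_t,X_t)$. Assume that the $X_t$ are identically distributed, that each $X_t$ is independent of $(\mathcal E,X_0,Y_1,\dots,X_{t-1},Y_t)$ (so the inputs are iid), and that $\mathbb P(Y_{t+1}\in\cdot\,|\,\mathcal E,H_t)=\mathcal E(\cdot|X_t)$ for every $t\ge 0$. *Regret.* An agent $\pi$ maps each history $H_t$ measurably to a probability measure $\pi(H_t)$ on $\mathcal Y$. For $T\in\{0,1,2,\dots\}$ the optimal regret is $$\mathcal R(T)=\inf_\pi\ \mathbb E\Big[\sum_{t=0}^{T-1}D_{\mathrm{KL}}\big(\mathcal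 E(\cdot|X_t)\,\big\|\,\pi(H_t)\big)\Big]\in[0,\infty].$$ *Rate-distortion function.* Fix any $s\ge 0$ and let $(X,Y)=(X_s,Y_{s+1})$. A proxy is a random variable $\tilde{\mathcal E}$ on $\Omega$, with values in any measurable space, such that $\tilde{\mathcal E}\perp(X,Y)\,|\,\mathcal E$. Its distortion is $\mathbb E[D_{\mathrm{KL}}(P^*\|\tilde P)]$, where $P^*=\mathcal E(\cdot|X)$ and $\tilde P=\mathbb P(Y\in\cdot\,|\,\tilde{\mathcal E},X)$. For $\epsilon\ge 0$ let $$\mathbb H_\epsilon(\mathcal E)=\inf\big\{\mathbb I(\mathcal E;\tilde{\mathcal E}) : \tilde{\mathcal E}\text{ a proxy with } \mathbb E[D_{\mathrm{KL}}(P^*\|\tilde P)]\le\epsilon\big\}\in[0,\infty],$$ where $\mathbb I(A;B)$ is the mutual information, that is, the KL divergence of the joint law of $(A,B)$ from the product of the laws of $A$ and $B$. Then, for every $T\in\{0,1,2,\dots\}$, $$\sup_{\epsilon\ge 0}\min\{\mathbb H_\epsilon(\mathcal E),\ \epsilon T\}\ \le\ \mathcal R(T)\ \le\ \inf_{\epsilon\ge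 0}\big(\mathbb H_\epsilon(\mathcal E)+\epsilon T\big).$$ -/

import Mathlib

open MeasureTheory ProbabilityTheory InformationTheory
open scoped ENNReal NNReal

noncomputable section

namespace RateDistortion

universe uΩ uΘ uX uY

/-- Values of the history `H_t = (X_0, Y_1, …, X_{t-1}, Y_t, X_t)`: the `t` input-output pairs
already observed, and the current input. -/
abbrev History (𝒳 : Type uX) (𝒴 : Type uY) (t : ℕ) : Type (max uX uY) :=
  (Fin t → 𝒳 × 𝒴) × 𝒳

variable {Ω : Type uΩ} {Θ : Type uΘ} {𝒳 : Type uX} {𝒴 : Type uY}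

/-- The first `t` data pairs `(X_0, Y_1), …, (X_{t-1}, Y_t)`. Throughout, `X t` is the input `X_t`
and `Y t` is the output `Y_{t+1}` that the environment gives in response to the input `X_t`. -/
def pastPairs (X : ℕ → Ω → 𝒳) (Y : ℕ → Ω → 𝒴) (t : ℕ) (ω : Ω) : Fin t → 𝒳 × 𝒴 :=
  fun i => (X i ω, Y i ω)

/-- The random history `H_t`. -/
def history (X : ℕ → Ω → 𝒳) (Y : ℕ → Ω → 𝒴) (t : ℕ) (ω : Ω) : History 𝒳 𝒴 t :=
  (pastPairs X Y t ω, X t ω)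

variable [MeasurableSpace Ω] [MeasurableSpace Θ] [MeasurableSpace 𝒳] [MeasurableSpace 𝒴]

/-- The target distribution `P*_t = κ (E, X_t)` as a function of `(E, H_t)`. -/
def targetKernel (κ : Kernel (Θ × 𝒳) 𝒴) (t : ℕ) : Kernel (Θ × History 𝒳 𝒴 t) 𝒴 :=
  κ.comap (fun p => (p.1, p.2.2)) (by fun_prop)

instance (κ : Kernel (Θ × 𝒳) 𝒴) [IsMarkovKernel κ] (t : ℕ) :
    IsMarkovKernel (targetKernel κ t) := by
  unfold targetKernel
  infer_instance

/-- The data generating process. `Θ` is the space of environments; the environment `θ : Θ`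
prescribes to an input `x` the distribution `κ (θ, x)` of the output, so that the random
environment `E` is the random function `x ↦ κ (E, x)`. The inputs are iid and carry no information
on the environment or the past: `X_t` has the law of `X_0` and is independent of `E` together with
the first `t` data pairs. Given `E` and `H_t`, the output `Y_{t+1}` is drawn from `κ (E, X_t)`. -/
structure IsDataGeneratingProcess (P : Measure Ω) (κ : Kernel (Θ × 𝒳) 𝒴)
    (E : Ω → Θ) (X : ℕ → Ω → 𝒳) (Y : ℕ → Ω → 𝒴) : Prop where
  measurable_env : Measurable E
  measurable_input : ∀ t, Measurable (X t)
  measurable_output : ∀ t, Measurable (Y t)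
  identDistrib_input : ∀ t, IdentDistrib (X t) (X 0) P P
  indep_input : ∀ t, IndepFun (X t) (fun ω => (E ω, pastPairs X Y t ω)) P
  output_law : ∀ t, HasCondDistrib (Y t) (fun ω => (E ω, history X Y t ω))
    (targetKernel κ t) P

/-- An agent: for every `t`, a measurable rule that turns a history `H_t` into a probability
distribution on outputs, the prediction `P_t = π(H_t)`. -/
structure Agent (𝒳 : Type uX) (𝒴 : Type uY) [MeasurableSpace 𝒳] [MeasurableSpace 𝒴] where
  predict : ∀ t : ℕ, Kernel (History 𝒳 𝒴 t) 𝒴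
  isMarkov : ∀ t, IsMarkovKernel (predict t)

/-- The expected cumulative error `E[∑_{t < T} KL(P*_t ‖ P_t)]` of the agent `π`, where
`P*_t = κ (E, X_t)` is the target distribution. -/
def agentRegret (P : Measure Ω) (κ : Kernel (Θ × 𝒳) 𝒴) (E : Ω → Θ) (X : ℕ → Ω → 𝒳)
    (Y : ℕ → Ω → 𝒴) (π : Agent 𝒳 𝒴) (T : ℕ) : ℝ≥0∞ :=
  ∫⁻ ω, ∑ t ∈ Finset.range T, klDiv (κ (E ω, X t ω)) (π.predict t (history X Y t ω)) ∂P

/-- The optimal regret `R(T)`. -/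
def optimalRegret (P : Measure Ω) (κ : Kernel (Θ × 𝒳) 𝒴) (E : Ω → Θ) (X : ℕ → Ω → 𝒳)
    (Y : ℕ → Ω → 𝒴) (T : ℕ) : ℝ≥0∞ :=
  ⨅ π : Agent 𝒳 𝒴, agentRegret P κ E X Y π T

/-- The mutual information `I(A; B)`, in nats: the KL divergence of the joint law from the product
of the marginal laws. -/
def mutualInfo {α β : Type*} [MeasurableSpace α] [MeasurableSpace β] (P : Measure Ω)
    (A : Ω → α) (B : Ω → β) : ℝ≥0∞ :=
  klDiv (P.map (fun ω => (A ω, B ω))) ((P.map A).prod (P.map B))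

/-- `A` and `B` are conditionally independent given `C`:
`P(A ∈ S, B ∈ S' | C) = P(A ∈ S | C) P(B ∈ S' | C)` almost surely, for all measurable `S, S'`.
(This is stated here without regularity assumptions on the probability space.) -/
def CondIndepGiven {α β γ : Type*} [MeasurableSpace α] [MeasurableSpace β] [mγ : MeasurableSpace γ]
    (P : Measure Ω) (A : Ω → α) (B : Ω → β) (C : Ω → γ) : Prop :=
  ∀ (S : Set α) (S' : Set β), MeasurableSet S → MeasurableSet S' →
    P⟦A ⁻¹' S ∩ B ⁻¹' S' | mγ.comap C⟧ =ᵐ[P]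
      P⟦A ⁻¹' S | mγ.comap C⟧ * P⟦B ⁻¹' S' | mγ.comap C⟧

/-- `F` is an environment proxy: a random variable with `F ⊥ (X, Y) | E`, where `(X, Y)` is an
input-output pair. -/
structure IsProxy {Θ' : Type*} [MeasurableSpace Θ'] (P : Measure Ω) (E : Ω → Θ)
    (X : Ω → 𝒳) (Y : Ω → 𝒴) (F : Ω → Θ') : Prop where
  measurable : Measurable F
  condIndep : CondIndepGiven P F (fun ω => (X ω, Y ω)) E

/-- The distortion `E[KL(P* ‖ P̃)]` of the proxy `F`, where `P* = κ (E, X)` is the target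
distribution and `P̃ = P(Y ∈ · | F, X)` is the prediction based on the proxy. -/
def distortion {Θ' : Type*} [MeasurableSpace Θ'] [StandardBorelSpace 𝒴] [Nonempty 𝒴]
    (P : Measure Ω) [IsFiniteMeasure P] (κ : Kernel (Θ × 𝒳) 𝒴) (E : Ω → Θ)
    (X : Ω → 𝒳) (Y : Ω → 𝒴) (F : Ω → Θ') : ℝ≥0∞ :=
  ∫⁻ ω, klDiv (κ (E ω, X ω)) (condDistrib Y (fun ω => (F ω, X ω)) P (F ω, X ω)) ∂P

/-- The rate-distortion function `H_ε(E)`: the infimum of `I(E; F)` over the proxies `F` of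
distortion at most `ε` (`∞` if there is none). The values of `F` may lie in any measurable space.
(It is no restriction to take that space in the universe of `Ω`: a random variable on `Ω` carries
the same information as the identity map from `Ω` to `Ω` with the σ-algebra that it generates.) -/
def rateDistortion [StandardBorelSpace 𝒴] [Nonempty 𝒴]
    (P : Measure Ω) [IsFiniteMeasure P] (κ : Kernel (Θ × 𝒳) 𝒴) (E : Ω → Θ)
    (X : Ω → 𝒳) (Y : Ω → 𝒴) (ε : ℝ≥0) : ℝ≥0∞ :=
  ⨅ (Θ' : Type uΩ) (_ : MeasurableSpace Θ') (F : Ω → Θ') (_ : IsProxy P E X Y F)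
    (_ : distortion P κ E X Y F ≤ ε), mutualInfo P E F

end RateDistortion

end

/-! The regret of an agent is itself a relative entropy. Let the agent's predictions, together with
the input law, define a law `Q` of the first `T` pairs. By the chain rule the regret is the
divergence of the joint law of environment and data from (law of `E`) × `Q`
(`klDiv_env_pastPairs_eq_sum`), because the common input law costs nothing at each step.

Lower bound: if the regret is below `ε T`, some step `t < T` has error at most `ε`. A block of `t`
pairs observed after time `s` is jointly distributed with `E` like the first `t` pairs, and it is
independent of the pair at time `s` given `E`, so it is a proxy. The agent's rule at step `t`
predicts from it with error at most `ε`, and the conditional law does no worse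
(`IsProxy.distortion_le`). Its information on `E` is at most the divergence from a product with any
`Q`, which is the error accumulated before `t`.

Upper bound: given a proxy `F`, the Bayesian mixture over `F` of the proxy's predictions is an
agent. Adjoining `F` to the data can only increase the divergence. The chain rule then splits the
larger divergence into `I(E; F)` and `T` equal terms, each the distortion
(`agentRegret_mixtureAgent_le`). -/

noncomputable section

namespace RateDistortion

/-! ### Relative entropy of kernels and optimality of conditional laws -/

section KullbackLeibler

variable {α β γ : Type*} [MeasurableSpace α] [MeasurableSpace β] [MeasurableSpace γ]

/-- The countability assumption provides a jointly measurable version of the densities, and the set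
where absolute continuity fails is measurable. -/
lemma measurable_klDiv_kernel [MeasurableSpace.CountableOrCountablyGenerated α β]
    (κ η : Kernel α β) [IsFiniteKernel κ] [IsFiniteKernel η] :
    Measurable (fun a => klDiv (κ a) (η a)) := by
  classical
  have h : (fun a => klDiv (κ a) (η a)) = fun a => if κ a ≪ η a then
      ∫⁻ b, ENNReal.ofReal (klFun (Kernel.rnDeriv κ η a b).toReal) ∂(η a) else ∞ := by
    funext a
    rw [klDiv_eq_lintegral_klFun]
    congr 1
    refine lintegral_congr_ae ?_
    filter_upwards [Kernel.rnDeriv_eq_rnDeriv_measure (κ := κ) (η := η) (a := a)] with b hb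
    rw [hb]
  rw [h]
  refine Measurable.ite (Kernel.measurableSet_absolutelyContinuous κ η) ?_ measurable_const
  refine Measurable.lintegral_kernel_prod_right'
    (f := fun p => ENNReal.ofReal (klFun (Kernel.rnDeriv κ η p.1 p.2).toReal)) ?_
  have := Kernel.measurable_rnDeriv κ η
  fun_prop

lemma compProd_eq_withDensity_kernel_rnDeriv [MeasurableSpace.CountableOrCountablyGenerated α β]
    {μ : Measure α} [IsFiniteMeasure μ] {κ η : Kernel α β} [IsFiniteKernel κ] [IsFiniteKernel η]
    (h : ∀ᵐ a ∂μ, κ a ≪ η a) :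
    μ ⊗ₘ κ = (μ ⊗ₘ η).withDensity (fun p => Kernel.rnDeriv κ η p.1 p.2) := by
  have hm : Measurable (Function.uncurry (Kernel.rnDeriv κ η)) := Kernel.measurable_rnDeriv κ η
  rw [← Measure.compProd_withDensity hm]
  refine Measure.compProd_congr ?_
  filter_upwards [h] with a ha
  exact (Kernel.withDensity_rnDeriv_eq ha).symm

/-- The conditional KL divergence as an average of KL divergences. -/
lemma klDiv_compProd_eq_lintegral [MeasurableSpace.CountableOrCountablyGenerated α β]
    (μ : Measure α) [IsFiniteMeasure μ] (κ η : Kernel α β) [IsFiniteKernel κ]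
    [IsFiniteKernel η] :
    klDiv (μ ⊗ₘ κ) (μ ⊗ₘ η) = ∫⁻ a, klDiv (κ a) (η a) ∂μ := by
  by_cases h : ∀ᵐ a ∂μ, κ a ≪ η a
  · have hm : Measurable (fun p : α × β => Kernel.rnDeriv κ η p.1 p.2) :=
      Kernel.measurable_rnDeriv κ η
    have hac : μ ⊗ₘ κ ≪ μ ⊗ₘ η := Measure.absolutelyContinuous_compProd_right_iff.2 h
    have hd : (μ ⊗ₘ κ).rnDeriv (μ ⊗ₘ η) =ᵐ[μ ⊗ₘ η] fun p => Kernel.rnDeriv κ η p.1 p.2 := by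
      rw [compProd_eq_withDensity_kernel_rnDeriv h]
      exact Measure.rnDeriv_withDensity _ hm
    have hd' : ∀ᵐ p ∂(μ ⊗ₘ η), ENNReal.ofReal (klFun ((μ ⊗ₘ κ).rnDeriv (μ ⊗ₘ η) p).toReal) =
        ENNReal.ofReal (klFun (Kernel.rnDeriv κ η p.1 p.2).toReal) := by
      filter_upwards [hd] with p hp
      rw [hp]
    rw [klDiv_eq_lintegral_klFun_of_ac hac, lintegral_congr_ae hd',
      Measure.lintegral_compProd (by fun_prop)]
    refine lintegral_congr_ae ?_
    filter_upwards [h] with a ha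
    rw [klDiv_eq_lintegral_klFun_of_ac ha]
    refine lintegral_congr_ae ?_
    filter_upwards [Kernel.rnDeriv_eq_rnDeriv_measure (κ := κ) (η := η) (a := a)] with b hb
    rw [hb]
  -- Without absolute continuity both sides are infinite: the integrand is `∞` on a set that is not
  -- null.
  · rw [klDiv_of_not_ac (mt Measure.absolutelyContinuous_compProd_right_iff.1 h)]
    symm
    refine lintegral_eq_top_of_measure_eq_top_ne_zero
      (measurable_klDiv_kernel κ η).aemeasurable fun h0 => h ?_
    have : ∀ᵐ a ∂μ, klDiv (κ a) (η a) ≠ ∞ := by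
      rw [ae_iff]
      simpa using h0
    filter_upwards [this] with a ha
    exact (klDiv_ne_top_iff.1 ha).1

/-- Reweighting the reference measure by a function of `φ`, so that it agrees with `μ` on the law
of `φ`, does not increase the KL divergence. -/
lemma klDiv_withDensity_rnDeriv_map_le (μ ν : Measure α) [IsProbabilityMeasure μ]
    [IsProbabilityMeasure ν] {φ : α → β} (hφ : Measurable φ) :
    klDiv μ (ν.withDensity (fun a => (μ.map φ).rnDeriv (ν.map φ) (φ a))) ≤ klDiv μ ν := by
  by_cases htop : klDiv μ ν = ∞
  · simp [htop]
  obtain ⟨hac, hint⟩ := klDiv_ne_top_iff.1 htop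
  set ρ := (μ.map φ).rnDeriv (ν.map φ) with hρ
  have hρm : Measurable ρ := Measure.measurable_rnDeriv _ _
  have hρφ : Measurable (fun a => ρ (φ a)) := hρm.comp hφ
  have : IsProbabilityMeasure (μ.map φ) := Measure.isProbabilityMeasure_map hφ.aemeasurable
  have : IsProbabilityMeasure (ν.map φ) := Measure.isProbabilityMeasure_map hφ.aemeasurable
  have hac' : μ.map φ ≪ ν.map φ := hac.map hφ
  have hint' := integrable_llr_map hac hφ hint
  have : IsProbabilityMeasure (ν.withDensity fun a => ρ (φ a)) := by
    constructor
    rw [withDensity_apply _ MeasurableSet.univ, Measure.restrict_univ,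
      ← lintegral_map (μ := ν) hρm hφ, hρ, Measure.lintegral_rnDeriv hac', measure_univ]
  have hpos : ∀ᵐ a ∂μ, 0 < ρ (φ a) :=
    ae_of_ae_map hφ.aemeasurable (Measure.rnDeriv_pos hac')
  have hfin : ∀ᵐ a ∂μ, ρ (φ a) < ∞ :=
    ae_of_ae_map hφ.aemeasurable (hac'.ae_le (Measure.rnDeriv_lt_top _ _))
  set ν' := ν.withDensity (fun a => ρ (φ a)) with hν'
  have hdm : Measurable (μ.rnDeriv ν) := Measure.measurable_rnDeriv _ _
  have hμ : μ = ν'.withDensity (fun a => μ.rnDeriv ν a * (ρ (φ a))⁻¹) := by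
    rw [hν', ← withDensity_mul _ hρφ (by fun_prop)]
    conv_lhs => rw [← Measure.withDensity_rnDeriv_eq μ ν hac]
    refine withDensity_congr_ae ?_
    -- The bounds on `ρ ∘ φ` hold `μ`-a.e., hence `ν`-a.e. where `dμ/dν` is nonzero, which is the
    -- only place where they are needed.
    rw [← Measure.withDensity_rnDeriv_eq μ ν hac, ae_withDensity_iff hdm] at hpos hfin
    filter_upwards [hpos, hfin] with a h1 h2
    by_cases h0 : μ.rnDeriv ν a = 0
    · simp [h0]
    · simp only [Pi.mul_apply]
      rw [mul_comm, mul_assoc, ENNReal.inv_mul_cancel (h1 h0).ne' (h2 h0).ne, mul_one]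
  have hacν' : μ ≪ ν' := by
    rw [hμ]
    exact withDensity_absolutelyContinuous _ _
  have hd : μ.rnDeriv ν' =ᵐ[μ] fun a => μ.rnDeriv ν a * (ρ (φ a))⁻¹ := by
    refine hacν'.ae_eq ?_
    conv_lhs => rw [hμ]
    exact Measure.rnDeriv_withDensity _ (by fun_prop)
  -- Pythagorean identity: after integration, the gain is the divergence between the two laws of
  -- `φ`, which is nonnegative.
  have hllr : llr μ ν' =ᵐ[μ] fun a => llr μ ν a - llr (μ.map φ) (ν.map φ) (φ a) := by
    filter_upwards [hd, hpos, hfin, Measure.rnDeriv_pos hac,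
      hac.ae_le (Measure.rnDeriv_lt_top μ ν)] with a h1 h2 h3 h4 h5
    rw [llr, h1, llr, llr, ENNReal.toReal_mul, ENNReal.toReal_inv, Real.log_mul, Real.log_inv,
      sub_eq_add_neg]
    · exact (ENNReal.toReal_pos h4.ne' h5.ne).ne'
    · exact inv_ne_zero (ENNReal.toReal_pos h2.ne' h3.ne).ne'
  have hint2 : Integrable (fun a => llr (μ.map φ) (ν.map φ) (φ a)) μ :=
    hint'.comp_measurable hφ
  have hintν' : Integrable (llr μ ν') μ := (integrable_congr hllr).2 (hint.sub hint2)
  rw [klDiv_of_ac_of_integrable hacν' hintν', klDiv_of_ac_of_integrable hac hint]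
  refine ENNReal.ofReal_le_ofReal ?_
  rw [integral_congr_ae hllr, integral_sub hint hint2]
  have h0 := integral_llr_add_sub_measure_univ_nonneg hac' hint'
  rw [integral_map hφ.aemeasurable hint'.aestronglyMeasurable] at h0
  simp only [probReal_univ] at h0 ⊢
  linarith

/-- Among all reference measures `ν ×ˢ Q`, the divergence is minimal at the marginal law. -/
lemma klDiv_prod_snd_le (μ : Measure (α × β)) [IsProbabilityMeasure μ] (ν : Measure α)
    [IsProbabilityMeasure ν] (Q : Measure β) [IsProbabilityMeasure Q] :
    klDiv μ (ν.prod μ.snd) ≤ klDiv μ (ν.prod Q) := by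
  by_cases htop : klDiv μ (ν.prod Q) = ∞
  · simp [htop]
  have hac : μ.snd ≪ Q := by
    have := ((klDiv_ne_top_iff.1 htop).1).map measurable_snd
    rwa [Measure.map_snd_prod, measure_univ, one_smul] at this
  -- Reweighting `ν × Q` by the density of the second marginal turns `Q` into `μ.snd`.
  have h := klDiv_withDensity_rnDeriv_map_le μ (ν.prod Q) measurable_snd
  rw [Measure.map_snd_prod, measure_univ, one_smul] at h
  refine le_of_eq_of_le ?_ h
  congr 1
  change ν.prod μ.snd = (ν.prod Q).withDensity fun a => μ.snd.rnDeriv Q a.2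
  rw [← prod_withDensity_right (Measure.measurable_rnDeriv _ _),
    Measure.withDensity_rnDeriv_eq _ _ hac]

/-- Predicting `γ` from the second coordinate, the conditional law has the least expected
divergence. -/
lemma klDiv_compProd_comap_snd_le [MeasurableSpace.CountableOrCountablyGenerated β γ]
    (m : Measure (α × β)) [IsProbabilityMeasure m]
    (κ : Kernel (α × β) γ) [IsMarkovKernel κ] (η π : Kernel β γ) [IsMarkovKernel η]
    [IsMarkovKernel π] (hη : (m ⊗ₘ κ).map (fun p => (p.1.2, p.2)) = m.snd ⊗ₘ η) :
    klDiv (m ⊗ₘ κ) (m ⊗ₘ η.comap Prod.snd measurable_snd) ≤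
      klDiv (m ⊗ₘ κ) (m ⊗ₘ π.comap Prod.snd measurable_snd) := by
  by_cases htop : klDiv (m ⊗ₘ κ) (m ⊗ₘ π.comap Prod.snd measurable_snd) = ∞
  · simp [htop]
  have hφ : Measurable (fun p : (α × β) × γ => (p.1.2, p.2)) := by fun_prop
  have hmap : (m ⊗ₘ π.comap Prod.snd measurable_snd).map (fun p => (p.1.2, p.2)) =
      m.snd ⊗ₘ π := by
    ext s hs
    rw [Measure.map_apply hφ hs, Measure.compProd_apply (hφ hs), Measure.compProd_apply hs,
      Measure.snd, lintegral_map (Kernel.measurable_kernel_prodMk_left hs) measurable_snd]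
    rfl
  have hac : m.snd ⊗ₘ η ≪ m.snd ⊗ₘ π := by
    have := ((klDiv_ne_top_iff.1 htop).1).map hφ
    rwa [hη, hmap] at this
  have hac' := Measure.absolutelyContinuous_compProd_right_iff.1 hac
  have hac'' : ∀ᵐ a ∂m, η a.2 ≪ π a.2 := ae_of_ae_map measurable_snd.aemeasurable hac'
  -- With `φ` forgetting `α`, the reweighting factor is the density of `η` with respect to `π`, so
  -- the reweighted reference predicts with `η`.
  have h := klDiv_withDensity_rnDeriv_map_le (m ⊗ₘ κ)
    (m ⊗ₘ π.comap Prod.snd measurable_snd) hφ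
  rw [hη, hmap] at h
  refine le_of_eq_of_le ?_ h
  congr 1
  have hm : Measurable (fun p : β × γ => Kernel.rnDeriv η π p.1 p.2) :=
    Kernel.measurable_rnDeriv η π
  have hd : (m.snd ⊗ₘ η).rnDeriv (m.snd ⊗ₘ π) =ᵐ[m.snd ⊗ₘ π]
      fun p => Kernel.rnDeriv η π p.1 p.2 := by
    rw [compProd_eq_withDensity_kernel_rnDeriv hac']
    exact Measure.rnDeriv_withDensity _ hm
  rw [← hmap] at hd
  have hd' := ae_of_ae_map hφ.aemeasurable hd
  rw [hmap] at hd'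
  rw [withDensity_congr_ae hd']
  have hm' : Measurable (fun p : (α × β) × γ => Kernel.rnDeriv η π p.1.2 p.2) := hm.comp hφ
  ext s hs
  rw [Measure.compProd_apply hs, withDensity_apply _ hs, ← lintegral_indicator hs,
    Measure.lintegral_compProd (hm'.indicator hs)]
  refine lintegral_congr_ae ?_
  filter_upwards [hac''] with a ha
  have hs' : MeasurableSet (Prod.mk a ⁻¹' s) := measurable_prodMk_left hs
  have := Kernel.withDensity_rnDeriv_eq ha
  rw [Kernel.comap_apply, ← this,
    Kernel.withDensity_apply' _ (Kernel.measurable_rnDeriv η π), ← lintegral_indicator hs']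
  rfl

end KullbackLeibler

/-! ### Rearranging composition products; one step of the process -/

section CompProd

variable {α β γ δ : Type*} [MeasurableSpace α] [MeasurableSpace β] [MeasurableSpace γ]
  [MeasurableSpace δ]

lemma klDiv_map_measurableEquiv (μ ν : Measure α) [IsFiniteMeasure μ] [IsFiniteMeasure ν]
    (e : α ≃ᵐ β) : klDiv (μ.map e) (ν.map e) = klDiv μ ν := by
  refine le_antisymm (klDiv_map_le μ ν e.measurable) ?_
  have h := klDiv_map_le (μ.map e) (ν.map e) e.symm.measurable
  rwa [Measure.map_map e.symm.measurable e.measurable,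
    Measure.map_map e.symm.measurable e.measurable, e.symm_comp_self, Measure.map_id,
    Measure.map_id] at h

lemma map_compProd_eq_map_compProd_comap (m : Measure α) [SFinite m] {g : α → β}
    (hg : Measurable g) (κ : Kernel β γ) [IsSFiniteKernel κ] :
    m.map g ⊗ₘ κ = (m ⊗ₘ κ.comap g hg).map (Prod.map g id) := by
  ext s hs
  rw [Measure.map_apply (by fun_prop) hs, Measure.compProd_apply hs,
    Measure.compProd_apply (hs.preimage (by fun_prop)),
    lintegral_map (Kernel.measurable_kernel_prodMk_left hs) hg]
  rfl

/-- Fubini: two draws that are independent given `a` may be made in either order. -/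
lemma map_compProd_comap_fst_swap (m : Measure α) [SFinite m] (κ : Kernel α β)
    [IsSFiniteKernel κ] (η : Kernel α γ) [IsSFiniteKernel η] :
    (m ⊗ₘ κ ⊗ₘ η.comap Prod.fst measurable_fst).map (fun p => ((p.1.1, p.2), p.1.2)) =
      m ⊗ₘ η ⊗ₘ κ.comap Prod.fst measurable_fst := by
  ext s hs
  have h1 : Measurable (fun p : (α × β) × γ => ((p.1.1, p.2), p.1.2)) := by fun_prop
  rw [Measure.map_apply h1 hs, ← lintegral_indicator_one hs,
    ← lintegral_indicator_one (h1 hs), Measure.lintegral_compProd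
      (measurable_one.indicator (h1 hs)), Measure.lintegral_compProd (measurable_one.indicator hs),
    Measure.lintegral_compProd (Measurable.lintegral_kernel_prod_right'
      (measurable_one.indicator (h1 hs))),
    Measure.lintegral_compProd (Measurable.lintegral_kernel_prod_right'
      (measurable_one.indicator hs))]
  refine lintegral_congr fun a => ?_
  simp only [Kernel.comap_apply]
  rw [lintegral_lintegral_swap]
  · rfl
  · have h2 : Measurable (fun p : β × γ => ((a, p.1), p.2)) := by fun_prop
    exact ((measurable_one.indicator (h1 hs)).comp h2).aemeasurable

lemma prod_compProd_comap_snd (μ : Measure α) [SFinite μ] (ν : Measure β) [SFinite ν]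
    (κ : Kernel β γ) [IsSFiniteKernel κ] :
    (μ.prod ν ⊗ₘ κ.comap Prod.snd measurable_snd).map (fun p => (p.1.1, (p.1.2, p.2))) =
      μ.prod (ν ⊗ₘ κ) := by
  ext s hs
  have h1 : Measurable (fun p : (α × β) × γ => (p.1.1, (p.1.2, p.2))) := by fun_prop
  rw [Measure.map_apply h1 hs, Measure.compProd_apply (h1 hs), Measure.prod_apply hs,
    lintegral_prod _ (Kernel.measurable_kernel_prodMk_left (h1 hs)).aemeasurable]
  refine lintegral_congr fun a => ?_
  rw [Measure.compProd_apply (measurable_prodMk_left hs)]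
  rfl

lemma map_prod_eq_map_prod (m : Measure α) [SFinite m] (ν : Measure γ) [SFinite ν] {g : α → β}
    (hg : Measurable g) : (m.map g).prod ν = (m.prod ν).map (Prod.map g id) := by
  conv_lhs => rw [← Measure.map_id (μ := ν)]
  rw [Measure.map_prod_map _ _ hg measurable_id]

/-- The kernel that draws an input from `ν` and then an output from `κ`. -/
def stepKernel (ν : Measure β) (κ : Kernel (α × β) γ) : Kernel α (β × γ) :=
  Kernel.const α ν ⊗ₖ κ

instance (ν : Measure β) [IsProbabilityMeasure ν] (κ : Kernel (α × β) γ) [IsMarkovKernel κ] :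
    IsMarkovKernel (stepKernel ν κ) := by
  unfold stepKernel
  infer_instance

lemma compProd_stepKernel (m : Measure α) [SFinite m] (ν : Measure β) [SFinite ν]
    (κ : Kernel (α × β) γ) [IsSFiniteKernel κ] :
    m ⊗ₘ stepKernel ν κ = (m.prod ν ⊗ₘ κ).map MeasurableEquiv.prodAssoc := by
  rw [stepKernel, ← Measure.compProd_assoc', Measure.compProd_const]

lemma stepKernel_comap (ν : Measure β) [SFinite ν] (κ : Kernel (α × β) γ) [IsSFiniteKernel κ]
    {g : δ → α} (hg : Measurable g) :
    (stepKernel ν κ).comap g hg =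
      stepKernel ν (κ.comap (fun p : δ × β => (g p.1, p.2)) (by fun_prop)) := by
  ext a s hs
  rw [Kernel.comap_apply, stepKernel, stepKernel, Kernel.compProd_apply hs,
    Kernel.compProd_apply hs]
  rfl

/-- Both steps draw the input from the same law, so only the outputs contribute. -/
lemma klDiv_compProd_stepKernel [MeasurableSpace.CountableOrCountablyGenerated (α × β) γ]
    (m : Measure α) [IsFiniteMeasure m] (ν : Measure β) [IsFiniteMeasure ν]
    (κ η : Kernel (α × β) γ) [IsFiniteKernel κ] [IsFiniteKernel η] :
    klDiv (m ⊗ₘ stepKernel ν κ) (m ⊗ₘ stepKernel ν η) =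
      ∫⁻ q, klDiv (κ q) (η q) ∂(m.prod ν) := by
  rw [compProd_stepKernel, compProd_stepKernel, klDiv_map_measurableEquiv,
    klDiv_compProd_eq_lintegral]

end CompProd

/-! ### Laws of sequentially generated data -/

section Sequence

variable {α β Z : Type*} [MeasurableSpace α] [MeasurableSpace β] [MeasurableSpace Z]

/-- Appending a value to a finite sequence, next to a parameter. -/
def snocEquiv (α Z : Type*) [MeasurableSpace α] [MeasurableSpace Z] (t : ℕ) :
    (α × (Fin t → Z)) × Z ≃ᵐ α × (Fin (t + 1) → Z) where
  toFun p := (p.1.1, Fin.snoc (α := fun _ => Z) p.1.2 p.2)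
  invFun q := ((q.1, fun i => q.2 i.castSucc), q.2 (Fin.last t))
  left_inv p := by simp
  right_inv q := by
    ext i
    · rfl
    · refine Fin.lastCases ?_ (fun i => ?_) i <;> simp
  measurable_toFun := by
    refine measurable_fst.fst.prodMk (measurable_pi_iff.2 fun i => ?_)
    refine Fin.lastCases ?_ (fun i => ?_) i
    · simpa using measurable_snd
    · simp only [Fin.snoc_castSucc]
      fun_prop
  measurable_invFun := by
    simp only [Equiv.coe_fn_symm_mk]
    fun_prop

lemma snocEquiv_apply (t : ℕ) (p : (α × (Fin t → Z)) × Z) :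
    snocEquiv α Z t p = (p.1.1, Fin.snoc (α := fun _ => Z) p.1.2 p.2) := rfl

/-- The joint law of a parameter with law `μ` and the first `t` terms of a sequence in which the
next term is drawn from `S t`, given the parameter and the previous terms. -/
def seqMeasure (μ : Measure α) (S : ∀ t, Kernel (α × (Fin t → Z)) Z) :
    ∀ t, Measure (α × (Fin t → Z))
  | 0 => μ.map (fun a => (a, Fin.elim0))
  | t + 1 => (seqMeasure μ S t ⊗ₘ S t).map (snocEquiv α Z t)

instance isProbabilityMeasure_seqMeasure (μ : Measure α) [IsProbabilityMeasure μ]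
    (S : ∀ t, Kernel (α × (Fin t → Z)) Z) [∀ t, IsMarkovKernel (S t)] (t : ℕ) :
    IsProbabilityMeasure (seqMeasure μ S t) := by
  induction t with
  | zero => exact Measure.isProbabilityMeasure_map (by fun_prop)
  | succ t _ => exact Measure.isProbabilityMeasure_map (snocEquiv α Z t).measurable.aemeasurable

/-- The chain rule, iterated; every term is averaged over the law generated by `S`, never over that
of `R`. -/
lemma klDiv_seqMeasure (μ ν : Measure α) [IsProbabilityMeasure μ] [IsProbabilityMeasure ν]
    (S R : ∀ t, Kernel (α × (Fin t → Z)) Z) [∀ t, IsMarkovKernel (S t)]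
    [∀ t, IsMarkovKernel (R t)] (t : ℕ) :
    klDiv (seqMeasure μ S t) (seqMeasure ν R t) = klDiv μ ν +
      ∑ i ∈ Finset.range t, klDiv (seqMeasure μ S i ⊗ₘ S i) (seqMeasure μ S i ⊗ₘ R i) := by
  induction t with
  | zero =>
    simp only [seqMeasure, Finset.range_zero, Finset.sum_empty, add_zero]
    refine le_antisymm (klDiv_map_le μ ν (by fun_prop)) ?_
    have h := klDiv_map_le (μ.map (fun a => (a, (Fin.elim0 : Fin 0 → Z))))
      (ν.map (fun a => (a, (Fin.elim0 : Fin 0 → Z)))) measurable_fst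
    rw [Measure.map_map (by fun_prop) (by fun_prop),
      Measure.map_map (by fun_prop) (by fun_prop)] at h
    simpa [Function.comp_def] using h
  | succ t ih =>
    rw [Finset.sum_range_succ, ← add_assoc, ← ih, seqMeasure, seqMeasure,
      klDiv_map_measurableEquiv, klDiv_compProd_eq_add]

lemma seqMeasure_map (μ : Measure α) [IsProbabilityMeasure μ] {g : α → β} (hg : Measurable g)
    (S : ∀ t, Kernel (β × (Fin t → Z)) Z) [∀ t, IsMarkovKernel (S t)] (t : ℕ) :
    (seqMeasure μ (fun t => (S t).comap (Prod.map g id) (by fun_prop)) t).map (Prod.map g id) =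
      seqMeasure (μ.map g) S t := by
  induction t with
  | zero =>
    simp only [seqMeasure]
    rw [Measure.map_map (by fun_prop) (by fun_prop), Measure.map_map (by fun_prop) (by fun_prop)]
    rfl
  | succ t ih =>
    simp only [seqMeasure]
    rw [← ih, map_compProd_eq_map_compProd_comap _ (by fun_prop) (S t),
      Measure.map_map (by fun_prop) (by fun_prop), Measure.map_map (by fun_prop) (by fun_prop)]
    rfl

lemma seqMeasure_prod (μ : Measure α) [IsProbabilityMeasure μ] (ν : Measure β)
    [IsProbabilityMeasure ν] (S : ∀ t, Kernel (β × (Fin t → Z)) Z) [∀ t, IsMarkovKernel (S t)]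
    (t : ℕ) :
    (seqMeasure (μ.prod ν) (fun t => (S t).comap (fun p : (α × β) × (Fin t → Z) =>
      (p.1.2, p.2)) (by fun_prop)) t).map (fun p => (p.1.1, (p.1.2, p.2))) =
      μ.prod (seqMeasure ν S t) := by
  induction t with
  | zero =>
    simp only [seqMeasure]
    rw [Measure.map_map (by fun_prop) (by fun_prop)]
    conv_rhs => rw [← Measure.map_id (μ := μ)]
    rw [Measure.map_prod_map _ _ measurable_id (by fun_prop)]
    rfl
  | succ t ih =>
    simp only [seqMeasure]
    conv_rhs => rw [← Measure.map_id (μ := μ)]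
    rw [Measure.map_prod_map _ _ measurable_id (snocEquiv β Z t).measurable,
      ← prod_compProd_comap_snd, ← ih, map_compProd_eq_map_compProd_comap _ (by fun_prop),
      Measure.map_map (by fun_prop) (by fun_prop), Measure.map_map (by fun_prop) (by fun_prop),
      Measure.map_map (by fun_prop) (by fun_prop)]
    rfl

/-- All draws are independent given the parameter, so the draw from `J` can be moved from before the
sequence to after it. -/
lemma seqMeasure_compProd (μ : Measure α) [IsProbabilityMeasure μ] (K J : Kernel α Z)
    [IsMarkovKernel K] [IsMarkovKernel J] (t : ℕ) :
    (seqMeasure (μ ⊗ₘ J) (fun t => K.comap (fun p : (α × Z) × (Fin t → Z) => p.1.1)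
      (by fun_prop)) t).map (fun p => ((p.1.1, p.2), p.1.2)) =
      seqMeasure μ (fun t => K.comap (fun p : α × (Fin t → Z) => p.1) (by fun_prop)) t ⊗ₘ
        J.comap Prod.fst measurable_fst := by
  induction t with
  | zero =>
    simp only [seqMeasure]
    rw [map_compProd_eq_map_compProd_comap _ (by fun_prop),
      Measure.map_map (by fun_prop) (by fun_prop)]
    rfl
  | succ t ih =>
    simp only [seqMeasure]
    rw [map_compProd_eq_map_compProd_comap _ (by fun_prop)]
    have h := map_compProd_comap_fst_swap
      (seqMeasure μ (fun t => K.comap (fun p : α × (Fin t → Z) => p.1) (by fun_prop)) t)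
      (J.comap Prod.fst measurable_fst) (K.comap Prod.fst measurable_fst)
    rw [← ih, map_compProd_eq_map_compProd_comap _ (by fun_prop),
      Measure.map_map (by fun_prop) (by fun_prop)] at h
    refine Eq.trans ?_ (congrArg (Measure.map (Prod.map (snocEquiv α Z t) id)) h)
    rw [Measure.map_map (by fun_prop) (by fun_prop), Measure.map_map (by fun_prop) (by fun_prop)]
    rfl

lemma measurable_snoc (t : ℕ) :
    Measurable (fun p : (Fin t → Z) × Z => Fin.snoc (α := fun _ => Z) p.1 p.2) :=
  ((snocEquiv Unit Z t).measurable.comp (g := snocEquiv Unit Z t)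
    (f := fun p : (Fin t → Z) × Z => (((), p.1), p.2)) (by fun_prop)).snd

lemma map_snocEquiv_prod_compProd (μ : Measure α) [IsProbabilityMeasure μ] (t : ℕ)
    (Q : Measure (Fin t → Z)) [IsProbabilityMeasure Q] (R : Kernel (Fin t → Z) Z)
    [IsMarkovKernel R] :
    (μ.prod Q ⊗ₘ R.comap Prod.snd measurable_snd).map (snocEquiv α Z t) =
      μ.prod ((Q ⊗ₘ R).map (fun p => Fin.snoc (α := fun _ => Z) p.1 p.2)) := by
  have hs := measurable_snoc (Z := Z) t
  conv_rhs => rw [← Measure.map_id (μ := μ)]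
  rw [Measure.map_prod_map _ _ measurable_id hs, ← prod_compProd_comap_snd,
    Measure.map_map (by fun_prop) (by fun_prop)]
  rfl

lemma seqMeasure_zero_eq_prod (μ : Measure α) [IsProbabilityMeasure μ]
    (S : ∀ t, Kernel (α × (Fin t → Z)) Z) (Q : Measure (Fin 0 → Z)) [IsProbabilityMeasure Q] :
    seqMeasure μ S 0 = μ.prod Q := by
  -- There is only one empty sequence, so its law is forced.
  have hQ : Q = Measure.dirac Fin.elim0 := by
    ext s _
    rcases Subsingleton.set_cases (p := fun s => Q s = Measure.dirac Fin.elim0 s) (by simp)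
      (by simp) s with h
    exact h
  rw [hQ, Measure.prod_dirac]
  rfl

/-- A sequence whose steps ignore the parameter is independent of the parameter. -/
lemma seqMeasure_comap_snd_eq_prod (μ : Measure α) [IsProbabilityMeasure μ]
    (R : ∀ t, Kernel (Fin t → Z) Z) [∀ t, IsMarkovKernel (R t)]
    (M : ∀ t, Measure (Fin t → Z)) [∀ t, IsProbabilityMeasure (M t)]
    (hM : ∀ t, M (t + 1) = (M t ⊗ₘ R t).map (fun p => Fin.snoc (α := fun _ => Z) p.1 p.2))
    (t : ℕ) :
    seqMeasure μ (fun t => (R t).comap (fun p : α × (Fin t → Z) => p.2) (by fun_prop)) t =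
      μ.prod (M t) := by
  induction t with
  | zero => exact seqMeasure_zero_eq_prod μ _ (M 0)
  | succ t ih => rw [seqMeasure, ih, hM, ← map_snocEquiv_prod_compProd]

lemma exists_seqMeasure_comap_snd_eq_prod (μ : Measure α) [IsProbabilityMeasure μ]
    (R : ∀ t, Kernel (Fin t → Z) Z) [∀ t, IsMarkovKernel (R t)] (t : ℕ) :
    ∃ Q : Measure (Fin t → Z), IsProbabilityMeasure Q ∧
      seqMeasure μ (fun t => (R t).comap (fun p : α × (Fin t → Z) => p.2) (by fun_prop)) t =
        μ.prod Q := by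
  induction t with
  | zero => exact ⟨Measure.dirac Fin.elim0, inferInstance, seqMeasure_zero_eq_prod μ _ _⟩
  | succ t ih =>
    obtain ⟨Q, hQ, hQ'⟩ := ih
    exact ⟨_, Measure.isProbabilityMeasure_map (measurable_snoc t).aemeasurable, by
      rw [seqMeasure, hQ', map_snocEquiv_prod_compProd]⟩

end Sequence

/-! ### Conditional independence in terms of kernels -/

section CondIndep

variable {Ω α β γ : Type*} [MeasurableSpace Ω] [MeasurableSpace α] [MeasurableSpace β]
  [mγ : MeasurableSpace γ] {P : Measure Ω} [IsProbabilityMeasure P]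
  {A : Ω → α} {B : Ω → β} {C : Ω → γ} {K : Kernel γ β} [IsMarkovKernel K]

lemma condExp_indicator_ae_eq_kernel (hC : Measurable C) (hB : Measurable B)
    (hlaw : P.map (fun ω => (C ω, B ω)) = P.map C ⊗ₘ K) {S : Set β} (hS : MeasurableSet S) :
    P⟦B ⁻¹' S | mγ.comap C⟧ =ᵐ[P] fun ω => (K (C ω)).real S := by
  have hk : Measurable (fun c => (K c).real S) := (Kernel.measurable_coe K hS).ennreal_toReal
  have hkC : Integrable (fun ω => (K (C ω)).real S) P :=
    Integrable.of_bound (hk.comp hC).aestronglyMeasurable 1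
      (Filter.Eventually.of_forall fun ω => by
        rw [Real.norm_of_nonneg measureReal_nonneg]; exact measureReal_le_one)
  symm
  refine ae_eq_condExp_of_forall_setIntegral_eq hC.comap_le
    ((integrable_const 1).indicator (hB hS)) (fun _ _ _ => hkC.integrableOn) ?_
    (hk.comp (comap_measurable C)).aestronglyMeasurable
  rintro _ ⟨D, hD, rfl⟩ -
  rw [integral_indicator (hB hS), setIntegral_const, smul_eq_mul, mul_one,
    measureReal_restrict_apply (hB hS)]
  have h1 : P (B ⁻¹' S ∩ C ⁻¹' D) = ∫⁻ ω in C ⁻¹' D, K (C ω) S ∂P := by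
    have h2 : P.map (fun ω => (C ω, B ω)) (D ×ˢ S) = ∫⁻ ω in C ⁻¹' D, K (C ω) S ∂P := by
      rw [hlaw, Measure.compProd_apply_prod hD hS,
        setLIntegral_map hD (Kernel.measurable_coe K hS) hC]
    rw [← h2, Measure.map_apply (hC.prodMk hB) (hD.prod hS), Set.inter_comm]
    rfl
  rw [measureReal_def, h1, ← integral_toReal]
  · rfl
  · exact ((Kernel.measurable_coe K hS).comp hC).aemeasurable
  · exact Filter.Eventually.of_forall fun ω => measure_lt_top _ _

lemma map_eq_of_map_prod_eq (hC : Measurable C) (hA : Measurable A) (hB : Measurable B)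
    (hlaw : P.map (fun ω => ((C ω, A ω), B ω)) =
      P.map (fun ω => (C ω, A ω)) ⊗ₘ K.comap Prod.fst measurable_fst) :
    P.map (fun ω => (C ω, B ω)) = P.map C ⊗ₘ K := by
  have h1 : P.map C = (P.map (fun ω => (C ω, A ω))).map Prod.fst := by
    rw [Measure.map_map measurable_fst (by fun_prop)]; rfl
  rw [h1, map_compProd_eq_map_compProd_comap _ measurable_fst, ← hlaw,
    Measure.map_map (by fun_prop) (by fun_prop)]
  rfl

lemma condExp_indicator_mul_kernel (hC : Measurable C) (hA : Measurable A) {S : Set α}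
    (hS : MeasurableSet S) {S' : Set β} (hS' : MeasurableSet S') :
    P[fun ω => (A ⁻¹' S).indicator (fun _ => (1 : ℝ)) ω * (K (C ω)).real S' | mγ.comap C] =ᵐ[P]
      fun ω => (P⟦A ⁻¹' S | mγ.comap C⟧) ω * (K (C ω)).real S' := by
  have hk : Measurable (fun c => (K c).real S') := (Kernel.measurable_coe K hS').ennreal_toReal
  have hi : Integrable ((A ⁻¹' S).indicator (fun _ => (1 : ℝ))) P :=
    (integrable_const 1).indicator (hA hS)
  refine condExp_mul_of_stronglyMeasurable_right (g := fun ω => (K (C ω)).real S')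
    (hk.comp (comap_measurable C)).stronglyMeasurable ?_ hi
  refine hi.mul_bdd (c := 1) (hk.comp hC).aestronglyMeasurable
    (Filter.Eventually.of_forall fun ω => ?_)
  rw [Real.norm_of_nonneg measureReal_nonneg]; exact measureReal_le_one

/-- If the law of `B` given `(C, A)` depends on `C` only, then `A ⊥ B | C`. -/
lemma condIndepGiven_of_map_eq (hC : Measurable C) (hA : Measurable A) (hB : Measurable B)
    (hlaw : P.map (fun ω => ((C ω, A ω), B ω)) =
      P.map (fun ω => (C ω, A ω)) ⊗ₘ K.comap Prod.fst measurable_fst) :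
    CondIndepGiven P A B C := by
  intro S S' hS hS'
  have hCA : Measurable (fun ω => (C ω, A ω)) := hC.prodMk hA
  have h1 := condExp_indicator_ae_eq_kernel hC hB (map_eq_of_map_prod_eq hC hA hB hlaw) hS'
  have h2 := condExp_indicator_ae_eq_kernel hCA hB hlaw hS'
  have hiB : Integrable ((B ⁻¹' S').indicator (fun _ => (1 : ℝ))) P :=
    (integrable_const 1).indicator (hB hS')
  have hiAB : Integrable ((A ⁻¹' S ∩ B ⁻¹' S').indicator (fun _ => (1 : ℝ))) P :=
    (integrable_const 1).indicator ((hA hS).inter (hB hS'))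
  have hmul : (A ⁻¹' S ∩ B ⁻¹' S').indicator (fun _ => (1 : ℝ)) =
      (A ⁻¹' S).indicator (fun _ => (1 : ℝ)) * (B ⁻¹' S').indicator (fun _ => (1 : ℝ)) := by
    ext ω
    by_cases h1 : ω ∈ A ⁻¹' S <;> by_cases h2 : ω ∈ B ⁻¹' S' <;> simp_all
  have h8 := condExp_indicator_mul_kernel (K := K) (P := P) hC hA hS hS'
  set m' : MeasurableSpace Ω := MeasurableSpace.comap (fun ω => (C ω, A ω)) inferInstance
  have hm' : m' ≤ _ := hCA.comap_le
  have hle : mγ.comap C ≤ m' := by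
    rintro _ ⟨D, hD, rfl⟩
    exact ⟨Prod.fst ⁻¹' D, measurable_fst hD, rfl⟩
  have hAm : MeasurableSet[m'] (A ⁻¹' S) := ⟨Prod.snd ⁻¹' S, measurable_snd hS, rfl⟩
  -- Tower property: given `(C, A)` the event on `A` is known and `B` has law `K C`; conditioning on
  -- `C` then gives the product.
  have h3 : P⟦A ⁻¹' S ∩ B ⁻¹' S' | m'⟧ =ᵐ[P]
      fun ω => (A ⁻¹' S).indicator (fun _ => (1 : ℝ)) ω * (K (C ω)).real S' := by
    have h4 := condExp_mul_of_stronglyMeasurable_left (m := m') (μ := P)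
      (stronglyMeasurable_const.indicator hAm) (hmul ▸ hiAB) hiB
    rw [← hmul] at h4
    filter_upwards [h4, h2] with ω h5 h6
    rw [h5, Pi.mul_apply, h6]
    rfl
  have h7 : P⟦A ⁻¹' S ∩ B ⁻¹' S' | mγ.comap C⟧ =ᵐ[P] P[P⟦A ⁻¹' S ∩ B ⁻¹' S' | m'⟧ | mγ.comap C] :=
    (condExp_condExp_of_le hle hm').symm
  filter_upwards [h7, condExp_congr_ae (m := mγ.comap C) h3,
    h8, h1] with ω e1 e2 e3 e4
  rw [e1, e2, e3, Pi.mul_apply, e4]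

/-- If `A ⊥ B | C`, then the law of `B` given `(C, A)` depends on `C` only. -/
lemma map_eq_of_condIndepGiven (hC : Measurable C) (hA : Measurable A) (hB : Measurable B)
    (hlaw : P.map (fun ω => (C ω, B ω)) = P.map C ⊗ₘ K) (hind : CondIndepGiven P A B C) :
    P.map (fun ω => ((C ω, A ω), B ω)) =
      P.map (fun ω => (C ω, A ω)) ⊗ₘ K.comap Prod.fst measurable_fst := by
  have hCAB : Measurable (fun ω => ((C ω, A ω), B ω)) := by fun_prop
  have : IsProbabilityMeasure (P.map (fun ω => ((C ω, A ω), B ω))) :=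
    Measure.isProbabilityMeasure_map hCAB.aemeasurable
  have : IsProbabilityMeasure (P.map (fun ω => (C ω, A ω))) :=
    Measure.isProbabilityMeasure_map (by fun_prop)
  -- Finite measures on a triple product are determined by boxes, and on boxes conditional
  -- independence can be integrated over `C ⁻¹' D`.
  refine Measure.ext_prod₃_iff'.2 fun {D S S'} hD hS hS' => ?_
  have hiA : Integrable ((A ⁻¹' S).indicator (fun _ => (1 : ℝ))) P :=
    (integrable_const 1).indicator (hA hS)
  have hiAB : Integrable ((A ⁻¹' S ∩ B ⁻¹' S').indicator (fun _ => (1 : ℝ))) P :=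
    (integrable_const 1).indicator ((hA hS).inter (hB hS'))
  have hk : Measurable (fun c => (K c).real S') := (Kernel.measurable_coe K hS').ennreal_toReal
  have hiAk : Integrable (fun ω => (A ⁻¹' S).indicator (fun _ => (1 : ℝ)) ω *
      (K (C ω)).real S') P := by
    refine hiA.mul_bdd (c := 1) (hk.comp hC).aestronglyMeasurable
      (Filter.Eventually.of_forall fun ω => ?_)
    rw [Real.norm_of_nonneg measureReal_nonneg]; exact measureReal_le_one
  have hDm : MeasurableSet[mγ.comap C] (C ⁻¹' D) := ⟨D, hD, rfl⟩
  have hreal : P.real (C ⁻¹' D ∩ (A ⁻¹' S ∩ B ⁻¹' S')) =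
      ∫ ω in C ⁻¹' D ∩ A ⁻¹' S, (K (C ω)).real S' ∂P := by
    calc P.real (C ⁻¹' D ∩ (A ⁻¹' S ∩ B ⁻¹' S'))
        = ∫ ω in C ⁻¹' D, (A ⁻¹' S ∩ B ⁻¹' S').indicator (fun _ => (1 : ℝ)) ω ∂P := by
          rw [integral_indicator ((hA hS).inter (hB hS')), setIntegral_const, smul_eq_mul,
            mul_one, measureReal_restrict_apply ((hA hS).inter (hB hS')), Set.inter_comm]
      _ = ∫ ω in C ⁻¹' D, (P⟦A ⁻¹' S ∩ B ⁻¹' S' | mγ.comap C⟧) ω ∂P :=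
          (setIntegral_condExp hC.comap_le hiAB hDm).symm
      _ = ∫ ω in C ⁻¹' D, (P[fun ω => (A ⁻¹' S).indicator (fun _ => (1 : ℝ)) ω *
            (K (C ω)).real S' | mγ.comap C]) ω ∂P := by
          refine integral_congr_ae (ae_restrict_of_ae ?_)
          filter_upwards [hind S S' hS hS', condExp_indicator_ae_eq_kernel hC hB hlaw hS',
            condExp_indicator_mul_kernel (K := K) (P := P) hC hA hS hS'] with ω e1 e2 e3
          rw [e1, e3, Pi.mul_apply, e2]
      _ = ∫ ω in C ⁻¹' D, (A ⁻¹' S).indicator (fun _ => (1 : ℝ)) ω * (K (C ω)).real S' ∂P :=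
          setIntegral_condExp hC.comap_le hiAk hDm
      _ = ∫ ω in C ⁻¹' D ∩ A ⁻¹' S, (K (C ω)).real S' ∂P := by
          rw [← setIntegral_indicator (hA hS)]
          refine integral_congr_ae (Filter.Eventually.of_forall fun ω => ?_)
          by_cases hω : ω ∈ A ⁻¹' S <;> simp [hω]
  have hmeas : P (C ⁻¹' D ∩ (A ⁻¹' S ∩ B ⁻¹' S')) =
      ∫⁻ ω in C ⁻¹' D ∩ A ⁻¹' S, K (C ω) S' ∂P := by
    have hfin : ∫⁻ ω in C ⁻¹' D ∩ A ⁻¹' S, K (C ω) S' ∂P ≠ ∞ := by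
      refine ((lintegral_mono fun ω => prob_le_one).trans_lt ?_).ne
      simp
    rw [← ENNReal.toReal_eq_toReal_iff' (measure_ne_top _ _) hfin, ← measureReal_def, hreal,
      ← integral_toReal]
    · rfl
    · exact ((Kernel.measurable_coe K hS').comp hC).aemeasurable
    · exact Filter.Eventually.of_forall fun ω => measure_lt_top _ _
  rw [Measure.map_apply hCAB ((hD.prod hS).prod hS'),
    Measure.compProd_apply_prod (hD.prod hS) hS']
  simp only [Kernel.comap_apply]
  rw [setLIntegral_map (f := fun a : γ × α => K a.1 S') (hD.prod hS)
    ((Kernel.measurable_coe K hS').comp measurable_fst) (by fun_prop)]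
  refine Eq.trans (congrArg P ?_) hmeas
  ext ω
  simp [and_assoc]

end CondIndep

/-! ### Joint laws of environment and data; regret as a divergence -/

section DataGeneration

variable {Ω Θ 𝒳 𝒴 : Type*} [MeasurableSpace Ω] [MeasurableSpace Θ] [MeasurableSpace 𝒳]
  [MeasurableSpace 𝒴] {P : Measure Ω} {κ : Kernel (Θ × 𝒳) 𝒴} {E : Ω → Θ} {X : ℕ → Ω → 𝒳}
  {Y : ℕ → Ω → 𝒴}

namespace IsDataGeneratingProcess

lemma measurable_pastPairs (h : IsDataGeneratingProcess P κ E X Y) (t : ℕ) :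
    Measurable (pastPairs X Y t) :=
  measurable_pi_iff.2 fun i => (h.measurable_input i).prodMk (h.measurable_output i)

lemma measurable_history (h : IsDataGeneratingProcess P κ E X Y) (t : ℕ) :
    Measurable (history X Y t) :=
  (h.measurable_pastPairs t).prodMk (h.measurable_input t)

variable [IsProbabilityMeasure P]

lemma isProbabilityMeasure_input (h : IsDataGeneratingProcess P κ E X Y) :
    IsProbabilityMeasure (P.map (X 0)) :=
  Measure.isProbabilityMeasure_map (h.measurable_input 0).aemeasurable

lemma map_prod_input (h : IsDataGeneratingProcess P κ E X Y) {A : Type*} [MeasurableSpace A]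
    {V : Ω → A} (n : ℕ) {g : Θ × (Fin n → 𝒳 × 𝒴) → A} (hg : Measurable g)
    (hV : ∀ ω, V ω = g (E ω, pastPairs X Y n ω)) :
    P.map (fun ω => (V ω, X n ω)) = (P.map V).prod (P.map (X 0)) := by
  have hVm : Measurable V := by
    rw [funext hV]
    exact hg.comp (h.measurable_env.prodMk (h.measurable_pastPairs n))
  have hind : IndepFun V (X n) P := by
    have := (h.indep_input n).symm.comp hg measurable_id
    rwa [show g ∘ (fun ω => (E ω, pastPairs X Y n ω)) = V from (funext hV).symm] at this
  rw [(indepFun_iff_map_prod_eq_prod_map_map hVm.aemeasurable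
    (h.measurable_input n).aemeasurable).1 hind, (h.identDistrib_input n).map_eq]

variable [IsMarkovKernel κ]

/-- Given the environment and any function of the first `n` pairs, the next pair consists of a
fresh input and the response of the environment. -/
lemma map_prod_pair (h : IsDataGeneratingProcess P κ E X Y) {A : Type*} [MeasurableSpace A]
    {V : Ω → A} (n : ℕ) {g : Θ × (Fin n → 𝒳 × 𝒴) → A} (hg : Measurable g) {q : A → Θ}
    (hq : Measurable q) (hV : ∀ ω, V ω = g (E ω, pastPairs X Y n ω)) (hE : ∀ a, q (g a) = a.1) :
    P.map (fun ω => (V ω, (X n ω, Y n ω))) =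
      P.map V ⊗ₘ (stepKernel (P.map (X 0)) κ).comap q hq := by
  have := h.isProbabilityMeasure_input
  have hX := h.measurable_input n
  have hY := h.measurable_output n
  have hH := h.measurable_history n
  have hEm := h.measurable_env
  have hG : Measurable (fun p : Θ × History 𝒳 𝒴 n => (g (p.1, p.2.1), p.2.2)) :=
    (hg.comp (by fun_prop)).prodMk (by fun_prop)
  have hVX : P.map (fun ω => (V ω, X n ω)) = (P.map (fun ω => (E ω, history X Y n ω))).map
      (fun p : Θ × History 𝒳 𝒴 n => (g (p.1, p.2.1), p.2.2)) := by
    rw [Measure.map_map hG (by fun_prop)]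
    congr 1
    ext1 ω
    simp [hV ω, history]
  have hker : (κ.comap (fun p : A × 𝒳 => (q p.1, p.2)) (by fun_prop)).comap _ hG =
      targetKernel κ n := by
    ext1 p
    simp [targetKernel, Kernel.comap_apply, hE]
  rw [stepKernel_comap, compProd_stepKernel, ← h.map_prod_input n hg hV, hVX,
    map_compProd_eq_map_compProd_comap _ hG, hker, ← (h.output_law n).map_eq,
    Measure.map_map (by fun_prop) (by fun_prop), Measure.map_map (by fun_prop) (by fun_prop)]
  congr 1
  ext1 ω
  simp [hV ω, history, MeasurableEquiv.prodAssoc]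

/-- Used with `n = 0` and `V = E` for the first pairs, and with `n = s + 1` and `V` the environment
with the pair at time `s` for the later ones. -/
lemma map_prod_consecutive_pairs (h : IsDataGeneratingProcess P κ E X Y) {A : Type*}
    [MeasurableSpace A] {V : Ω → A} (n : ℕ) {g : Θ × (Fin n → 𝒳 × 𝒴) → A} (hg : Measurable g)
    {q : A → Θ} (hq : Measurable q) (hV : ∀ ω, V ω = g (E ω, pastPairs X Y n ω))
    (hE : ∀ a, q (g a) = a.1) (t : ℕ) :
    P.map (fun ω => (V ω, fun i : Fin t => (X (n + i) ω, Y (n + i) ω))) =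
      seqMeasure (P.map V) (fun t => (stepKernel (P.map (X 0)) κ).comap
        (fun p : A × (Fin t → 𝒳 × 𝒴) => q p.1) (by fun_prop)) t := by
  have := h.isProbabilityMeasure_input
  have hVm : Measurable V := by
    rw [funext hV]
    exact hg.comp (h.measurable_env.prodMk (h.measurable_pastPairs n))
  have hp (i : ℕ) : Measurable (fun ω => (X i ω, Y i ω)) :=
    (h.measurable_input i).prodMk (h.measurable_output i)
  induction t with
  | zero =>
    simp only [seqMeasure]
    rw [Measure.map_map (by fun_prop) hVm]
    congr 1
    ext1 ω
    exact Prod.ext rfl (Subsingleton.elim _ _)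
  | succ t ih =>
    have hps : Measurable (fun ω (i : Fin t) => (X (n + i) ω, Y (n + i) ω)) :=
      measurable_pi_iff.2 fun i => hp _
    simp only [seqMeasure]
    -- `V` with the `t` pairs after it is again a function of `E` and the first `n + t` pairs, and
    -- it still determines `E`.
    rw [← ih, ← h.map_prod_pair (n + t) (V := fun ω => (V ω, fun i : Fin t =>
      (X (n + i) ω, Y (n + i) ω))) (g := fun p => (g (p.1, fun i => p.2 (Fin.castAdd t i)),
        fun i => p.2 (Fin.natAdd n i))) ((hg.comp (by fun_prop)).prodMk (by fun_prop))
        (q := fun p => q p.1) (by fun_prop) (fun ω => by rw [hV ω]; rfl) (fun a => by simp [hE]),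
      Measure.map_map (snocEquiv A _ t).measurable (by fun_prop)]
    congr 1
    ext1 ω
    refine Prod.ext rfl (funext fun i => ?_)
    refine Fin.lastCases ?_ (fun i => ?_) i <;> simp [snocEquiv_apply]

lemma map_env_pastPairs (h : IsDataGeneratingProcess P κ E X Y) (t : ℕ) :
    P.map (fun ω => (E ω, pastPairs X Y t ω)) =
      seqMeasure (P.map E) (fun t => (stepKernel (P.map (X 0)) κ).comap
        (fun p : Θ × (Fin t → 𝒳 × 𝒴) => p.1) (by fun_prop)) t := by
  have h1 := h.map_prod_consecutive_pairs (V := E) 0 measurable_fst (q := id) measurable_id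
    (fun _ => rfl) (fun _ => rfl) t
  simp only [zero_add] at h1
  exact h1

lemma map_env_pair (h : IsDataGeneratingProcess P κ E X Y) (s : ℕ) :
    P.map (fun ω => (E ω, (X s ω, Y s ω))) = P.map E ⊗ₘ stepKernel (P.map (X 0)) κ :=
  h.map_prod_pair (V := E) s measurable_fst (q := id) measurable_id
    (fun _ => rfl) (fun _ => rfl)

/-- The pairs after time `s`, together with the pair at time `s`, are distributed like the first
pairs together with the pair that follows them. -/
lemma map_env_later_pairs_pair (h : IsDataGeneratingProcess P κ E X Y) (s t : ℕ) :
    P.map (fun ω => ((E ω, fun i : Fin t => (X (s + 1 + i) ω, Y (s + 1 + i) ω)),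
      (X s ω, Y s ω))) =
      P.map (fun ω => (E ω, pastPairs X Y t ω)) ⊗ₘ
        (stepKernel (P.map (X 0)) κ).comap Prod.fst measurable_fst := by
  have := h.isProbabilityMeasure_input
  have := Measure.isProbabilityMeasure_map (μ := P) h.measurable_env.aemeasurable
  have hp (i : ℕ) : Measurable (fun ω => (X i ω, Y i ω)) :=
    (h.measurable_input i).prodMk (h.measurable_output i)
  have hps : Measurable (fun ω (i : Fin t) => (X (s + 1 + i) ω, Y (s + 1 + i) ω)) :=
    measurable_pi_iff.2 fun i => hp _
  have hEm := h.measurable_env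
  rw [h.map_env_pastPairs, ← seqMeasure_compProd, ← h.map_env_pair s,
    ← h.map_prod_consecutive_pairs (V := fun ω => (E ω, (X s ω, Y s ω))) (s + 1)
      (g := fun p => (p.1, p.2 (Fin.last s))) (by fun_prop) measurable_fst
      (fun ω => rfl) (fun a => rfl) t, Measure.map_map (by fun_prop) (by fun_prop)]
  rfl

lemma map_env_later_pairs (h : IsDataGeneratingProcess P κ E X Y) (s t : ℕ) :
    P.map (fun ω => (E ω, fun i : Fin t => (X (s + 1 + i) ω, Y (s + 1 + i) ω))) =
      P.map (fun ω => (E ω, pastPairs X Y t ω)) := by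
  have := h.isProbabilityMeasure_input
  have hp (i : ℕ) : Measurable (fun ω => (X i ω, Y i ω)) :=
    (h.measurable_input i).prodMk (h.measurable_output i)
  have hps : Measurable (fun ω (i : Fin t) => (X (s + 1 + i) ω, Y (s + 1 + i) ω)) :=
    measurable_pi_iff.2 fun i => hp _
  have hEm := h.measurable_env
  have h1 := congrArg Measure.fst (h.map_env_later_pairs_pair s t)
  rwa [Measure.fst_compProd, Measure.fst_map_prodMk (hp s)] at h1

end IsDataGeneratingProcess

lemma measurable_klDiv_predict [MeasurableSpace.CountablyGenerated 𝒴] (κ : Kernel (Θ × 𝒳) 𝒴)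
    [IsMarkovKernel κ] (π : Agent 𝒳 𝒴) (t : ℕ) :
    Measurable (fun q : Θ × History 𝒳 𝒴 t => klDiv (κ (q.1, q.2.2)) (π.predict t q.2)) := by
  have := π.isMarkov t
  exact measurable_klDiv_kernel (targetKernel κ t) ((π.predict t).comap Prod.snd measurable_snd)

lemma agentRegret_eq_sum [MeasurableSpace.CountablyGenerated 𝒴] [IsMarkovKernel κ]
    (h : IsDataGeneratingProcess P κ E X Y) (π : Agent 𝒳 𝒴) (T : ℕ) :
    agentRegret P κ E X Y π T = ∑ i ∈ Finset.range T,
        ∫⁻ ω, klDiv (κ (E ω, X i ω)) (π.predict i (history X Y i ω)) ∂P := by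
  rw [agentRegret, lintegral_finsetSum]
  intro i _
  exact (measurable_klDiv_predict κ π i).comp
    (h.measurable_env.prodMk (h.measurable_history i))

variable [IsProbabilityMeasure P] [IsMarkovKernel κ]

/-- The law of the next pair in the mind of the agent `π`. -/
def agentStep (ν : Measure 𝒳) (π : Agent 𝒳 𝒴) (t : ℕ) : Kernel (Fin t → 𝒳 × 𝒴) (𝒳 × 𝒴) :=
  stepKernel ν (π.predict t)

instance (ν : Measure 𝒳) [IsProbabilityMeasure ν] (π : Agent 𝒳 𝒴) (t : ℕ) :
    IsMarkovKernel (agentStep ν π t) := by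
  have := π.isMarkov t
  unfold agentStep
  infer_instance

/-- The cumulative error of an agent is the divergence of the joint law of environment and data
from the product of the law of the environment and the agent's law of the data. -/
lemma klDiv_env_pastPairs_eq_sum [MeasurableSpace.CountablyGenerated 𝒴]
    (h : IsDataGeneratingProcess P κ E X Y) (π : Agent 𝒳 𝒴) (t : ℕ) :
    klDiv (P.map (fun ω => (E ω, pastPairs X Y t ω)))
        (seqMeasure (P.map E) (fun t => (agentStep (P.map (X 0)) π t).comap
          (fun p : Θ × (Fin t → 𝒳 × 𝒴) => p.2) (by fun_prop)) t) =
      ∑ i ∈ Finset.range t,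
        ∫⁻ ω, klDiv (κ (E ω, X i ω)) (π.predict i (history X Y i ω)) ∂P := by
  have := h.isProbabilityMeasure_input
  have := Measure.isProbabilityMeasure_map (μ := P) h.measurable_env.aemeasurable
  have := π.isMarkov
  rw [h.map_env_pastPairs, klDiv_seqMeasure, klDiv_self, zero_add]
  refine Finset.sum_congr rfl fun i _ => ?_
  have hEm := h.measurable_env
  have hX := h.measurable_input i
  have hpp := h.measurable_pastPairs i
  have hH := h.measurable_history i
  rw [← h.map_env_pastPairs, agentStep, stepKernel_comap, stepKernel_comap,
    klDiv_compProd_stepKernel, ← h.map_prod_input (V := fun ω => (E ω, pastPairs X Y i ω)) i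
      measurable_id (fun _ => rfl)]
  simp only [Kernel.comap_apply]
  rw [lintegral_map (f := fun q : (Θ × (Fin i → 𝒳 × 𝒴)) × 𝒳 =>
    klDiv (κ (q.1.1, q.2)) (π.predict i (q.1.2, q.2)))
    ((measurable_klDiv_predict κ π i).comp (g := fun q : Θ × History 𝒳 𝒴 i => _)
      (f := fun q : (Θ × (Fin i → 𝒳 × 𝒴)) × 𝒳 => (q.1.1, (q.1.2, q.2))) (by fun_prop))
    (by fun_prop)]
  rfl

end DataGeneration

/-! ### Proxies and their distortion -/

section Proxy

variable {Ω Θ 𝒳 𝒴 Θ' : Type*} [MeasurableSpace Ω] [MeasurableSpace Θ] [MeasurableSpace 𝒳]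
  [MeasurableSpace 𝒴] [MeasurableSpace Θ'] {P : Measure Ω} [IsProbabilityMeasure P]
  {κ : Kernel (Θ × 𝒳) 𝒴} [IsMarkovKernel κ] {E : Ω → Θ} {X : ℕ → Ω → 𝒳} {Y : ℕ → Ω → 𝒴}
  {F : Ω → Θ'} {s : ℕ}

/-- Given the environment, a proxy and an input, the output is the response of the environment. -/
lemma IsProxy.map_env_proxy_input_output (hF : IsProxy P E (X s) (Y s) F)
    (h : IsDataGeneratingProcess P κ E X Y) :
    P.map (fun ω => (((E ω, F ω), X s ω), Y s ω)) =
      (P.map (fun ω => (E ω, F ω))).prod (P.map (X 0)) ⊗ₘ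
        κ.comap (fun p : (Θ × Θ') × 𝒳 => (p.1.1, p.2)) (by fun_prop) := by
  have := h.isProbabilityMeasure_input
  have hE := h.measurable_env
  have hX := h.measurable_input s
  have hY := h.measurable_output s
  have hFm := hF.measurable
  have h1 := map_eq_of_condIndepGiven hE hFm (hX.prodMk hY) (h.map_env_pair s) hF.condIndep
  rw [stepKernel_comap, compProd_stepKernel] at h1
  have h2 := congrArg (Measure.map MeasurableEquiv.prodAssoc.symm) h1
  rw [Measure.map_map (by fun_prop) (by fun_prop), Measure.map_map (by fun_prop) (by fun_prop),
    MeasurableEquiv.symm_comp_self, Measure.map_id] at h2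
  exact h2

lemma IsProxy.map_env_proxy_input (hF : IsProxy P E (X s) (Y s) F)
    (h : IsDataGeneratingProcess P κ E X Y) :
    P.map (fun ω => ((E ω, F ω), X s ω)) =
      (P.map (fun ω => (E ω, F ω))).prod (P.map (X 0)) := by
  have := h.isProbabilityMeasure_input
  have h1 := congrArg Measure.fst (hF.map_env_proxy_input_output h)
  rwa [Measure.fst_compProd, Measure.fst_map_prodMk (h.measurable_output s)] at h1

lemma measurable_klDiv_comap [MeasurableSpace.CountablyGenerated 𝒴] (κ : Kernel (Θ × 𝒳) 𝒴)
    [IsMarkovKernel κ] (η : Kernel (Θ' × 𝒳) 𝒴) [IsMarkovKernel η] :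
    Measurable (fun q : (Θ × Θ') × 𝒳 => klDiv (κ (q.1.1, q.2)) (η (q.1.2, q.2))) :=
  measurable_klDiv_kernel (κ.comap (fun q : (Θ × Θ') × 𝒳 => (q.1.1, q.2)) (by fun_prop))
    (η.comap (fun q : (Θ × Θ') × 𝒳 => (q.1.2, q.2)) (by fun_prop))

/-- A proxy together with `E` is independent of `X s`, so the error depends only on the joint law of
`E` and `F` and on the input law. This is what lets errors at different times be compared. -/
lemma IsProxy.lintegral_klDiv_eq [MeasurableSpace.CountablyGenerated 𝒴]
    (hF : IsProxy P E (X s) (Y s) F) (h : IsDataGeneratingProcess P κ E X Y)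
    (η : Kernel (Θ' × 𝒳) 𝒴) [IsMarkovKernel η] :
    ∫⁻ ω, klDiv (κ (E ω, X s ω)) (η (F ω, X s ω)) ∂P =
      ∫⁻ q, klDiv (κ (q.1.1, q.2)) (η (q.1.2, q.2))
        ∂((P.map (fun ω => (E ω, F ω))).prod (P.map (X 0))) := by
  have hE := h.measurable_env
  have hX := h.measurable_input s
  have hFm := hF.measurable
  rw [← hF.map_env_proxy_input h, lintegral_map (measurable_klDiv_comap κ η) (by fun_prop)]

/-- No prediction from the proxy and the input has a smaller expected error than the conditional
law of the output. -/
lemma IsProxy.distortion_le [StandardBorelSpace 𝒴] [Nonempty 𝒴]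
    (hF : IsProxy P E (X s) (Y s) F) (h : IsDataGeneratingProcess P κ E X Y)
    (η : Kernel (Θ' × 𝒳) 𝒴) [IsMarkovKernel η] :
    distortion P κ E (X s) (Y s) F ≤ ∫⁻ ω, klDiv (κ (E ω, X s ω)) (η (F ω, X s ω)) ∂P := by
  have hE := h.measurable_env
  have hX := h.measurable_input s
  have hY := h.measurable_output s
  have hFm := hF.measurable
  have := h.isProbabilityMeasure_input
  set c := condDistrib (Y s) (fun ω => (F ω, X s ω)) P with hc
  set m := P.map (fun ω => (E ω, (F ω, X s ω))) with hm
  have : IsProbabilityMeasure m := Measure.isProbabilityMeasure_map (by fun_prop)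
  set κ' : Kernel (Θ × (Θ' × 𝒳)) 𝒴 := κ.comap (fun p => (p.1, p.2.2)) (by fun_prop) with hκ'
  have hlaw : P.map (fun ω => ((E ω, (F ω, X s ω)), Y s ω)) = m ⊗ₘ κ' := by
    have h1 : m = (P.map (fun ω => ((E ω, F ω), X s ω))).map MeasurableEquiv.prodAssoc := by
      rw [Measure.map_map (by fun_prop) (by fun_prop)]
      rfl
    rw [h1, map_compProd_eq_map_compProd_comap _ (by fun_prop), hF.map_env_proxy_input h]
    refine Eq.trans ?_ (congrArg (Measure.map _) (hF.map_env_proxy_input_output h))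
    rw [Measure.map_map (by fun_prop) (by fun_prop)]
    rfl
  -- With `E` averaged out, the true response law becomes the conditional law of the output given
  -- proxy and input.
  have hη : (m ⊗ₘ κ').map (fun p => (p.1.2, p.2)) = m.snd ⊗ₘ c := by
    have h1 : m.snd = P.map (fun ω => (F ω, X s ω)) := Measure.snd_map_prodMk hE
    rw [h1, compProd_map_condDistrib hY.aemeasurable, ← hlaw,
      Measure.map_map (by fun_prop) (by fun_prop)]
    rfl
  have hle := klDiv_compProd_comap_snd_le m κ' c η hη
  rw [klDiv_compProd_eq_lintegral, klDiv_compProd_eq_lintegral, hm,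
    lintegral_map (measurable_klDiv_kernel _ _) (by fun_prop),
    lintegral_map (measurable_klDiv_kernel _ _) (by fun_prop)] at hle
  exact hle

end Proxy

/-! ### Lower bound: a block of data as a proxy -/

section LowerBound

variable {Ω Θ 𝒳 𝒴 : Type*} [MeasurableSpace Ω] [MeasurableSpace Θ] [MeasurableSpace 𝒳]
  [MeasurableSpace 𝒴] {P : Measure Ω} [IsProbabilityMeasure P]
  {κ : Kernel (Θ × 𝒳) 𝒴} [IsMarkovKernel κ] {E : Ω → Θ} {X : ℕ → Ω → 𝒳} {Y : ℕ → Ω → 𝒴}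

lemma mutualInfo_comp_le {α β : Type*} [MeasurableSpace α] [MeasurableSpace β] {F : Ω → α}
    (hE : Measurable E) (hF : Measurable F) {u : α → β} (hu : Measurable u) :
    mutualInfo P E (fun ω => u (F ω)) ≤ mutualInfo P E F := by
  have := Measure.isProbabilityMeasure_map (μ := P) hE.aemeasurable
  have := Measure.isProbabilityMeasure_map (μ := P) hF.aemeasurable
  have := Measure.isProbabilityMeasure_map (μ := P) (hE.prodMk hF).aemeasurable
  have h1 := klDiv_map_le (P.map (fun ω => (E ω, F ω))) ((P.map E).prod (P.map F))
    (g := Prod.map id u) (by fun_prop)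
  rw [← Measure.map_prod_map _ _ measurable_id hu, Measure.map_id,
    Measure.map_map (by fun_prop) (by fun_prop), Measure.map_map hu hF] at h1
  exact h1

lemma mutualInfo_le_klDiv_prod {α : Type*} [MeasurableSpace α] {F : Ω → α} (hE : Measurable E)
    (hF : Measurable F) (Q : Measure α) [IsProbabilityMeasure Q] :
    mutualInfo P E F ≤ klDiv (P.map (fun ω => (E ω, F ω))) ((P.map E).prod Q) := by
  have := Measure.isProbabilityMeasure_map (μ := P) hE.aemeasurable
  have := Measure.isProbabilityMeasure_map (μ := P) (hE.prodMk hF).aemeasurable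
  have h1 := klDiv_prod_snd_le (P.map (fun ω => (E ω, F ω))) (P.map E) Q
  rwa [Measure.snd_map_prodMk hE] at h1

/-- The pairs after time `s` are a proxy whose information on the environment is at most the
cumulative error of any agent, and which allows any agent's next prediction. -/
lemma min_rateDistortion_le_agentRegret [StandardBorelSpace 𝒳] [StandardBorelSpace 𝒴]
    [Nonempty 𝒴] (h : IsDataGeneratingProcess P κ E X Y) (s T : ℕ) (ε : ℝ≥0) (π : Agent 𝒳 𝒴) :
    min (rateDistortion P κ E (X s) (Y s) ε) (ε * T) ≤ agentRegret P κ E X Y π T := by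
  rw [agentRegret_eq_sum h]
  set loss : ℕ → ℝ≥0∞ := fun i =>
    ∫⁻ ω, klDiv (κ (E ω, X i ω)) (π.predict i (history X Y i ω)) ∂P with hloss
  by_cases hT : (ε : ℝ≥0∞) * T ≤ ∑ i ∈ Finset.range T, loss i
  · exact (min_le_right _ _).trans hT
  refine (min_le_left _ _).trans ?_
  obtain ⟨t, htT, ht⟩ : ∃ t < T, loss t ≤ ε := by
    by_contra! hcon
    refine hT ?_
    calc (ε : ℝ≥0∞) * T = ∑ _i ∈ Finset.range T, (ε : ℝ≥0∞) := by simp [mul_comm]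
      _ ≤ _ := Finset.sum_le_sum fun i hi => (hcon i (Finset.mem_range.1 hi)).le
  have := h.isProbabilityMeasure_input
  have := Measure.isProbabilityMeasure_map (μ := P) h.measurable_env.aemeasurable
  have := π.isMarkov t
  have hE := h.measurable_env
  have hX := h.measurable_input
  have hY := h.measurable_output
  have hXY (i : ℕ) : Measurable (fun ω => (X i ω, Y i ω)) := (hX i).prodMk (hY i)
  have hpp := h.measurable_pastPairs t
  obtain ⟨ω₀⟩ : Nonempty Ω := nonempty_of_isProbabilityMeasure P
  have : Nonempty (Fin t → 𝒳 × 𝒴) := ⟨pastPairs X Y t ω₀⟩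
  let G : Ω → (Fin t → 𝒳 × 𝒴) := fun ω i => (X (s + 1 + i) ω, Y (s + 1 + i) ω)
  have hG : Measurable G := measurable_pi_iff.2 fun i => hXY _
  have hGproxy : IsProxy P E (X s) (Y s) G := by
    refine ⟨hG, condIndepGiven_of_map_eq (K := stepKernel (P.map (X 0)) κ) hE hG (hXY s) ?_⟩
    rw [h.map_env_later_pairs_pair s t, h.map_env_later_pairs s t]
  -- The infimum in `rateDistortion` ranges over value spaces in the universe of `Ω`. The block is
  -- therefore coded as a real number, lifted to that universe, and decoded by `g`; this uses that
  -- the space of blocks is standard Borel.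
  obtain ⟨j, hj⟩ := MeasureTheory.exists_measurableEmbedding_real (Fin t → 𝒳 × 𝒴)
  obtain ⟨g, hg, hgj⟩ : ∃ g : ℝ → (Fin t → 𝒳 × 𝒴), Measurable g ∧ ∀ p, g (j p) = p := by
    obtain ⟨g, hg, hgj⟩ := hj.exists_measurable_extend measurable_id fun _ => inferInstance
    exact ⟨g, hg, fun p => congrFun hgj p⟩
  have hu : Measurable (fun p => ULift.up (j p)) := measurable_up.comp hj.measurable
  have hdown : Measurable (fun f : ULift ℝ => g f.down) := hg.comp measurable_down
  let F : Ω → ULift ℝ := fun ω => ULift.up (j (G ω))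
  have hF : IsProxy P E (X s) (Y s) F :=
    ⟨hu.comp hG, fun S S' hS hS' => hGproxy.condIndep _ S' (hu hS) hS'⟩
  have hdist : distortion P κ E (X s) (Y s) F ≤ ε := by
    refine le_trans ?_ ht
    refine (hF.distortion_le h ((π.predict t).comap (fun q : ULift ℝ × 𝒳 => (g q.1.down, q.2))
      ((hdown.comp measurable_fst).prodMk measurable_snd))).trans_eq ?_
    simp only [Kernel.comap_apply, F, hgj]
    -- Predicting at time `s` from the later block has the same expected error as the agent's step
    -- `t`, that is, `loss t`.
    rw [hGproxy.lintegral_klDiv_eq h, h.map_env_later_pairs s t,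
      ← h.map_prod_input (V := fun ω => (E ω, pastPairs X Y t ω)) t measurable_id (fun _ => rfl),
      lintegral_map (measurable_klDiv_comap κ (π.predict t)) (by fun_prop)]
    rfl
  have hinfo : mutualInfo P E F ≤ ∑ i ∈ Finset.range T, loss i := by
    obtain ⟨Q, hQ, hQ'⟩ := exists_seqMeasure_comap_snd_eq_prod (P.map E)
      (agentStep (P.map (X 0)) π) t
    calc mutualInfo P E F ≤ mutualInfo P E G := mutualInfo_comp_le hE hG hu
      _ ≤ klDiv (P.map (fun ω => (E ω, G ω))) ((P.map E).prod Q) :=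
          mutualInfo_le_klDiv_prod hE hG Q
      _ = ∑ i ∈ Finset.range t, loss i := by
          rw [h.map_env_later_pairs s t, ← hQ', klDiv_env_pastPairs_eq_sum h]
      _ ≤ ∑ i ∈ Finset.range T, loss i :=
          Finset.sum_le_sum_of_subset (Finset.range_mono htT.le)
  rw [rateDistortion]
  refine iInf_le_of_le (ULift ℝ) <| iInf_le_of_le inferInstance ?_
  exact iInf_le_of_le F <| iInf_le_of_le hF <| iInf_le_of_le hdist hinfo

end LowerBound

/-! ### Upper bound: the mixture agent of a proxy -/

section UpperBound

variable {Ω Θ 𝒳 𝒴 Θ' : Type*} [MeasurableSpace Ω] [MeasurableSpace Θ] [MeasurableSpace 𝒳]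
  [MeasurableSpace 𝒴] [MeasurableSpace Θ'] {P : Measure Ω} [IsProbabilityMeasure P]
  {κ : Kernel (Θ × 𝒳) 𝒴} [IsMarkovKernel κ] {E : Ω → Θ} {X : ℕ → Ω → 𝒳} {Y : ℕ → Ω → 𝒴}
  {F : Ω → Θ'} {s : ℕ}

lemma fst_seqMeasure {α Z : Type*} [MeasurableSpace α] [MeasurableSpace Z] (μ : Measure α)
    [IsProbabilityMeasure μ] (S : ∀ t, Kernel (α × (Fin t → Z)) Z) [∀ t, IsMarkovKernel (S t)]
    (t : ℕ) : (seqMeasure μ S t).fst = μ := by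
  induction t with
  | zero =>
    rw [seqMeasure, Measure.fst_map_prodMk measurable_const]
    exact Measure.map_id
  | succ t ih =>
    rw [seqMeasure, Measure.fst, Measure.map_map measurable_fst (by fun_prop)]
    conv_rhs => rw [← ih, ← Measure.fst_compProd (seqMeasure μ S t) (S t)]
    rw [Measure.fst, Measure.fst, Measure.map_map measurable_fst measurable_fst]
    rfl

/-- The joint law of a proxy with law `μ` and pairs whose inputs have law `ν` and whose outputs
are predicted by `η` from the proxy. -/
def predictedLaw (μ : Measure Θ') (ν : Measure 𝒳) (η : Kernel (Θ' × 𝒳) 𝒴) (t : ℕ) :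
    Measure (Θ' × (Fin t → 𝒳 × 𝒴)) :=
  seqMeasure μ (fun t => (stepKernel ν η).comap (fun p : Θ' × (Fin t → 𝒳 × 𝒴) => p.1)
    (by fun_prop)) t

instance (μ : Measure Θ') [IsProbabilityMeasure μ] (ν : Measure 𝒳) [IsProbabilityMeasure ν]
    (η : Kernel (Θ' × 𝒳) 𝒴) [IsMarkovKernel η] (t : ℕ) :
    IsProbabilityMeasure (predictedLaw μ ν η t) := by
  unfold predictedLaw
  infer_instance

/-- The law of a history and the next output when the proxy is averaged out. -/
def mixtureLaw (μ : Measure Θ') (ν : Measure 𝒳) (η : Kernel (Θ' × 𝒳) 𝒴) (t : ℕ) :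
    Measure (History 𝒳 𝒴 t × 𝒴) :=
  ((predictedLaw μ ν η t).prod ν ⊗ₘ
    η.comap (fun q : (Θ' × (Fin t → 𝒳 × 𝒴)) × 𝒳 => (q.1.1, q.2)) (by fun_prop)).map
      (fun q => ((q.1.1.2, q.1.2), q.2))

instance (μ : Measure Θ') [IsProbabilityMeasure μ] (ν : Measure 𝒳) [IsProbabilityMeasure ν]
    (η : Kernel (Θ' × 𝒳) 𝒴) [IsMarkovKernel η] (t : ℕ) :
    IsProbabilityMeasure (mixtureLaw μ ν η t) :=
  Measure.isProbabilityMeasure_map (by fun_prop)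

/-- The agent that predicts with the conditional laws of the mixture. -/
def mixtureAgent [StandardBorelSpace 𝒴] [Nonempty 𝒴] (μ : Measure Θ') [IsProbabilityMeasure μ]
    (ν : Measure 𝒳) [IsProbabilityMeasure ν] (η : Kernel (Θ' × 𝒳) 𝒴) [IsMarkovKernel η] :
    Agent 𝒳 𝒴 where
  predict t := (mixtureLaw μ ν η t).condKernel
  isMarkov _ := inferInstance

lemma fst_mixtureLaw (μ : Measure Θ') [IsProbabilityMeasure μ] (ν : Measure 𝒳)
    [IsProbabilityMeasure ν] (η : Kernel (Θ' × 𝒳) 𝒴) [IsMarkovKernel η] (t : ℕ) :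
    (mixtureLaw μ ν η t).fst = (predictedLaw μ ν η t).snd.prod ν := by
  rw [Measure.snd, map_prod_eq_map_prod _ _ measurable_snd,
    ← Measure.fst_compProd ((predictedLaw μ ν η t).prod ν) (η.comap
      (fun q : (Θ' × (Fin t → 𝒳 × 𝒴)) × 𝒳 => (q.1.1, q.2)) (by fun_prop)),
    mixtureLaw, Measure.fst, Measure.fst, Measure.map_map measurable_fst (by fun_prop),
    Measure.map_map (by fun_prop) measurable_fst]
  rfl

/-- Disintegration: chaining the conditional laws of the mixture gives back the mixture, so the data
law that the mixture agent believes in is the marginal of `predictedLaw`. -/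
lemma snd_predictedLaw_succ [StandardBorelSpace 𝒴] [Nonempty 𝒴] (μ : Measure Θ')
    [IsProbabilityMeasure μ] (ν : Measure 𝒳) [IsProbabilityMeasure ν] (η : Kernel (Θ' × 𝒳) 𝒴)
    [IsMarkovKernel η] (t : ℕ) :
    (predictedLaw μ ν η (t + 1)).snd =
      ((predictedLaw μ ν η t).snd ⊗ₘ agentStep ν (mixtureAgent μ ν η) t).map
        (fun p => Fin.snoc (α := fun _ => 𝒳 × 𝒴) p.1 p.2) := by
  have hs := measurable_snoc (Z := 𝒳 × 𝒴) t
  have h1 : (predictedLaw μ ν η t).snd ⊗ₘ agentStep ν (mixtureAgent μ ν η) t =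
      (mixtureLaw μ ν η t).map MeasurableEquiv.prodAssoc := by
    have := (mixtureAgent μ ν η).isMarkov t
    rw [agentStep, compProd_stepKernel, ← fst_mixtureLaw]
    exact congrArg _ (Measure.disintegrate _ (mixtureLaw μ ν η t).condKernel)
  have h2 : predictedLaw μ ν η (t + 1) = (predictedLaw μ ν η t ⊗ₘ (stepKernel ν η).comap
      (fun p : Θ' × (Fin t → 𝒳 × 𝒴) => p.1) (by fun_prop)).map (snocEquiv Θ' _ t) := rfl
  rw [h1, h2, mixtureLaw, stepKernel_comap, compProd_stepKernel, Measure.snd,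
    Measure.map_map (by fun_prop) (by fun_prop), Measure.map_map (by fun_prop) (by fun_prop),
    Measure.map_map (by fun_prop) (by fun_prop), Measure.map_map (by fun_prop) (by fun_prop)]
  rfl

/-- Data processing followed by the chain rule, after adjoining the proxy to the parameter. Any
predictor `η` will do; the conditional law is chosen only in the main theorem. -/
lemma agentRegret_mixtureAgent_le [StandardBorelSpace 𝒴] [Nonempty 𝒴]
    (h : IsDataGeneratingProcess P κ E X Y) [IsProbabilityMeasure (P.map F)]
    [IsProbabilityMeasure (P.map (X 0))] (hF : IsProxy P E (X s) (Y s) F)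
    (η : Kernel (Θ' × 𝒳) 𝒴) [IsMarkovKernel η] (T : ℕ) :
    agentRegret P κ E X Y (mixtureAgent (P.map F) (P.map (X 0)) η) T ≤
      mutualInfo P E F + T * ∫⁻ ω, klDiv (κ (E ω, X s ω)) (η (F ω, X s ω)) ∂P := by
  have hE := h.measurable_env
  have hFm := hF.measurable
  have := Measure.isProbabilityMeasure_map (μ := P) hE.aemeasurable
  have := Measure.isProbabilityMeasure_map (μ := P) (hE.prodMk hFm).aemeasurable
  set ν := P.map (X 0)
  rw [agentRegret_eq_sum h, ← klDiv_env_pastPairs_eq_sum h,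
    seqMeasure_comap_snd_eq_prod (P.map E) _ (fun t => (predictedLaw (P.map F) ν η t).snd)
      (snd_predictedLaw_succ _ _ _)]
  let S : ∀ t, Kernel ((Θ × Θ') × (Fin t → 𝒳 × 𝒴)) (𝒳 × 𝒴) := fun t =>
    (stepKernel ν κ).comap (fun p : (Θ × Θ') × (Fin t → 𝒳 × 𝒴) => p.1.1) (by fun_prop)
  let R : ∀ t, Kernel ((Θ × Θ') × (Fin t → 𝒳 × 𝒴)) (𝒳 × 𝒴) := fun t =>
    (stepKernel ν η).comap (fun p : (Θ × Θ') × (Fin t → 𝒳 × 𝒴) => p.1.2) (by fun_prop)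
  have hSm (t : ℕ) : IsMarkovKernel (S t) := by unfold S; infer_instance
  have hRm (t : ℕ) : IsMarkovKernel (R t) := by unfold R; infer_instance
  -- The actual `F` may depend on the first `T` pairs beyond `E`. The data are therefore redrawn
  -- from `E` alone; this keeps the law of `(E, F)` and the law of environment and data, and no more
  -- is needed.
  have hA : (seqMeasure (P.map (fun ω => (E ω, F ω))) S T).map (fun p => (p.1.1, p.2)) =
      P.map (fun ω => (E ω, pastPairs X Y T ω)) := by
    have h1 := seqMeasure_map (P.map (fun ω => (E ω, F ω))) measurable_fst
      (fun t => (stepKernel ν κ).comap (fun p : Θ × (Fin t → 𝒳 × 𝒴) => p.1) (by fun_prop)) T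
    rw [Measure.map_map measurable_fst (by fun_prop)] at h1
    rw [h.map_env_pastPairs]
    exact h1
  have hC : (seqMeasure ((P.map E).prod (P.map F)) R T).map (fun p => (p.1.1, p.2)) =
      (P.map E).prod (predictedLaw (P.map F) ν η T).snd := by
    have h1 := seqMeasure_prod (P.map E) (P.map F)
      (fun t => (stepKernel ν η).comap (fun p : Θ' × (Fin t → 𝒳 × 𝒴) => p.1) (by fun_prop)) T
    conv_rhs => rw [← Measure.map_id (μ := P.map E)]
    rw [Measure.snd, Measure.map_prod_map _ _ measurable_id measurable_snd, predictedLaw, ← h1,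
      Measure.map_map (by fun_prop) (by fun_prop)]
    rfl
  rw [← hA, ← hC]
  refine (klDiv_map_le _ _ (by fun_prop)).trans_eq ?_
  rw [klDiv_seqMeasure, mutualInfo]
  congr 1
  -- The steps look only at `(E, F)` and a fresh input, so all `T` terms are equal.
  rw [← nsmul_eq_mul, ← Finset.card_range T, ← Finset.sum_const, Finset.card_range]
  refine Finset.sum_congr rfl fun i _ => ?_
  simp only [S, R]
  rw [stepKernel_comap, stepKernel_comap, klDiv_compProd_stepKernel, hF.lintegral_klDiv_eq h η]
  conv_rhs => rw [← fst_seqMeasure (P.map (fun ω => (E ω, F ω))) S i]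
  rw [Measure.fst, map_prod_eq_map_prod _ _ measurable_fst,
    lintegral_map (measurable_klDiv_comap κ η) (by fun_prop)]
  rfl

end UpperBound

end RateDistortion

end

theorem mainTheorem3 {Ω Θ 𝒳 𝒴 : Type*}
    [MeasurableSpace Ω] [MeasurableSpace Θ]
    [MeasurableSpace 𝒳] [StandardBorelSpace 𝒳]
    [MeasurableSpace 𝒴] [StandardBorelSpace 𝒴] [Nonempty 𝒴]
    (P : Measure Ω) [IsProbabilityMeasure P]
    (κ : Kernel (Θ × 𝒳) 𝒴) [IsMarkovKernel κ]
    (E : Ω → Θ) (X : ℕ → Ω → 𝒳) (Y : ℕ → Ω → 𝒴)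
    (h : RateDistortion.IsDataGeneratingProcess P κ E X Y)
    (s : ℕ) (T : ℕ) :
    (⨆ ε : ℝ≥0, min (RateDistortion.rateDistortion P κ E (X s) (Y s) ε) ((ε : ℝ≥0∞) * (T : ℝ≥0∞)))
        ≤ RateDistortion.optimalRegret P κ E X Y T ∧
      RateDistortion.optimalRegret P κ E X Y T ≤
        ⨅ ε : ℝ≥0,
          (RateDistortion.rateDistortion P κ E (X s) (Y s) ε + (ε : ℝ≥0∞) * (T : ℝ≥0∞)) := by
  refine ⟨iSup_le fun ε => le_iInf fun π =>
    RateDistortion.min_rateDistortion_le_agentRegret h s T ε π, le_iInf fun ε => ?_⟩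
  rw [RateDistortion.rateDistortion]
  simp only [ENNReal.iInf_add]
  refine le_iInf fun Θ' => le_iInf fun _ => le_iInf fun F => le_iInf fun hF => le_iInf fun hd => ?_
  have := h.isProbabilityMeasure_input
  have := Measure.isProbabilityMeasure_map (μ := P) hF.measurable.aemeasurable
  -- With the conditional law of the output as predictor, the error per step is the distortion by
  -- definition.
  refine (iInf_le _ _).trans ((RateDistortion.agentRegret_mixtureAgent_le h hF
    (condDistrib (Y s) (fun ω => (F ω, X s ω)) P) T).trans ?_)
  rw [mul_comm (ε : ℝ≥0∞)]
  gcongr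
  exact hd
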